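/- Let $\mu,\lambda>0$ and let $\mathrm{IG}(\mu,\lambda)$ be the inverse Gaussian distribution, with density $$\phi(x)=\sqrt{\tfrac{\lambda}{2\pi}}\,e^{\lambda/\mu}\,x^{-3/2}\exp\Big(-\tfrac{\lambda}{2\mu}\big(\tfrac{x}{\mu}+\tfrac{\mu}{x}\big)\Big)\quad(x>0),\qquad \phi(x)=0\quad(x\le 0).$$ Let $f:(0,\infty)\to\mathbb R$ be differentiable with $\lim_{x\to0}f(x)\phi(x)=\lim_{x\to\infty}f(x)\phi(x)=0$. For $X\sim\mathrm{IG}(\mu,\lambda)$ write $\mu_f(k,l,m)=\mathbb E[X^k f(X)^l f'(X)^m]$ and $\vartheta_f=\mu_f(2,1,0)-\mu^2\mu_f(0,1,0)$. Assume that $f(X)$, $X^2f(X)$, $X^2f'(X)$ have finite second moments and that $\vartheta_f\neq0$. Let $X_1,X_2,\dots$ be i.i.d. $\mathrm{IG}(\mu,\lambda)$, write $\overline{h(X)}=\frac1n\sum_{i=1}^n h(X_i)$, and let $$\hat\lambda_{f,\mathrm{IG}}=\frac{\overline X^2\big(2\,\overline{X^2f'(X)}+\overline{Xf(X)}\big)}{\overline{X^2f(X)}-\overline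 X^2\,\overline{f(X)}}$$ (with an arbitrary fixed value, say $0$, where the denominator vanishes). So $\hat\lambda_{f,\mathrm{IG}}=g(\overline Z)$ with $g(x_1,\dots,x_5)=x_1^2(2x_5+x_3)/(x_4-x_1^2x_2)$ and $Z_i=(X_i,f(X_i),X_if(X_i),X_i^2f(X_i),X_i^2f'(X_i))$; put $\mu_Z=\mathbb E[Z_1]$. Then $\hat\lambda_{f,\mathrm{IG}}$ is asymptotically normally distributed with asymptotic variance $\sigma^2_{f,\mathrm{IG}}$, that is, $\sigma^2_{f,\mathrm{IG}}>0$ and $(\hat\lambda_{f,\mathrm{IG}}-\lambda)/\sigma_{f,\mathrm{IG}}\to \mathrm N(0,1)$ in distribution as $n\to\infty$, where $$\begin{aligned} \sigma_{f,\mathrm{IG}}^2=\frac1n\Bigg[&\frac{\mu^4}{\vartheta_f^2}\Big[\mu_f(2,2,0)-\mu_f(1,1,0)\Big(\frac{\lambda\vartheta_f}{\mu^2}+2\mu_f(2,0,1)\Big)+4\mu_f(3,1,1)+4\mu_f(4,0,2)-4\mu_f^2(2,0,1)\Big]\\ &+\frac{2\lambda\mu}{\vartheta_f^2}\Big[\mu^3\Big(\mu_f(1,2,0)+2\mu_f(2,1,1)-\frac{\lambda\vartheta_f}{\mu^2}\mu_f(0,1,0)\Big)-\mu\big(\mu_f(3,2,0)+2\mu_f(4,1,1)\big)\\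 &\qquad+\mu_f(2,1,0)\Big(4\mu_f(2,1,0)+4\mu_f(3,0,1)-\frac{\lambda\vartheta_f}{\mu}\Big)\Big]\\ &+\frac{\lambda^2}{\mu\vartheta_f^2}\Big[\mu^5\mu_f(0,2,0)+\mu^3\mu_f(0,1,0)\big(\vartheta_f+\mu_f(2,1,0)\big)-2\mu^3\mu_f(2,2,0)\\ &\qquad+4\mu_f(2,1,0)\big(\mu^2\mu_f(1,1,0)-\mu^3\mu_f(0,1,0)-\mu_f(3,1,0)\big)+\mu\big(3\mu_f^2(2,1,0)+\mu_f(4,2,0)\big)\Big]\Bigg]. \end{aligned}$$ Its asymptotic bias is $\mathbb B_{f,\mathrm{IG}}$ in the following sense. Let $T_n=Dg(\mu_Z)(\overline Z-\mu_Z)+\frac12D^2g(\mu_Z)(\overline Z-\mu_Z,\overline Z-\mu_Z)$ be the second-order Taylor approximation of $\hat\lambda_{f,\mathrm{IG}}-\lambda$. Then $n\,(\hat\lambda_{f,\mathrm{IG}}-\lambda-T_n)\to0$ in probability, and for every $n\ge1$ the variable $T_n$ is integrable with $\mathbb E[T_n]=\mathbb B_{f,\mathrm{IG}}$, where $$\begin{aligned}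 \mathbb B_{f,\mathrm{IG}}=\frac1n\Bigg[&\frac1{\mu\vartheta_f^2}\Big[\mu^2\mu_f(2,1,0)\big(\mu_f(2,1,0)+3\mu^2\mu_f(0,1,0)\big)+\lambda\Big(\mu^5\mu_f(0,2,0)+\mu\,\mu_f(4,2,0)\\ &\qquad-2\mu_f(3,1,0)\mu_f(2,1,0)+4\mu^2\mu_f(1,1,0)\mu_f(2,1,0)-2\mu^3\mu_f(2,2,0)\Big)\Big]\\ &+\frac{\mu}{\vartheta_f^3}\Big[\mu_f(2,1,0)\Big(2\mu_f^2(2,1,0)-\mu\,\mu_f(3,2,0)+4\mu_f(2,1,0)\mu_f(3,0,1)-2\mu\,\mu_f(4,1,1)\\ &\qquad+\mu^3\big(\mu_f(1,2,0)+2\mu_f(2,1,1)\big)\Big)\\ &\quad-\mu^2\mu_f(0,1,0)\Big(2\mu_f(3,1,0)\big(2\mu_f(2,0,1)+\mu_f(1,1,0)\big)+2\mu_f^2(2,1,0)+4\mu_f(2,1,0)\mu_f(3,0,1)\\ &\qquad+\mu^3\big(\mu_f(1,2,0)+2\mu_f(2,1,1)\big)-\mu\big(\mu_f(3,2,0)+2\mu_f(4,1,1)\big)\Big)\Big]\Bigg].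 \end{aligned}$$ (Here $\mu_f^2(k,l,m)$ denotes $\mu_f(k,l,m)^2$.) -/

import Mathlib

open MeasureTheory ProbabilityTheory Filter Topology Set

noncomputable section

/-- Density of the inverse Gaussian distribution `IG(μ, lam)`, zero off `(0, ∞)`. -/
def igPDF (μ lam x : ℝ) : ℝ :=
  if 0 < x then
    Real.sqrt (lam / (2 * Real.pi)) * Real.exp (lam / μ) * x ^ (-(3 / 2) : ℝ) *
      Real.exp (-(lam / (2 * μ)) * (x / μ + μ / x))
  else 0

/-- The inverse Gaussian distribution `IG(μ, lam)`. -/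
def igMeasure (μ lam : ℝ) : Measure ℝ :=
  volume.withDensity fun x => ENNReal.ofReal (igPDF μ lam x)

/-- The mixed moment `μ_f(k,l,m) = E[X ^ k * f(X) ^ l * f'(X) ^ m]` of `X ∼ IG(μ, lam)`. -/
def igMoment (μ lam : ℝ) (f : ℝ → ℝ) (k l m : ℕ) : ℝ :=
  ∫ x, x ^ k * f x ^ l * deriv f x ^ m ∂(igMeasure μ lam)

/-- `ϑ_f = μ_f(2,1,0) - μ² μ_f(0,1,0)`. -/
def igTheta (μ lam : ℝ) (f : ℝ → ℝ) : ℝ :=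
  igMoment μ lam f 2 1 0 - μ ^ 2 * igMoment μ lam f 0 1 0

/-- The sample mean of `h(X_1), …, h(X_n)`; the sample points are `X 0, …, X (n - 1)`. -/
def sampleMean {Ω : Type*} (X : ℕ → Ω → ℝ) (h : ℝ → ℝ) (n : ℕ) (ω : Ω) : ℝ :=
  (1 / (n : ℝ)) * ∑ i ∈ Finset.range n, h (X i ω)

/-- The Stein-MM estimator of `lam` with weight function `f`. -/
def steinMM {Ω : Type*} (f : ℝ → ℝ) (X : ℕ → Ω → ℝ) (n : ℕ) (ω : Ω) : ℝ :=
  (sampleMean X (fun x => x) n ω) ^ 2 *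
      (2 * sampleMean X (fun x => x ^ 2 * deriv f x) n ω + sampleMean X (fun x => x * f x) n ω) /
    (sampleMean X (fun x => x ^ 2 * f x) n ω
      - (sampleMean X (fun x => x) n ω) ^ 2 * sampleMean X f n ω)

/-- The five statistics `(x, f(x), x f(x), x² f(x), x² f'(x))` entering the estimator. -/
def steinVec (f : ℝ → ℝ) (x : ℝ) : Fin 5 → ℝ :=
  ![x, f x, x * f x, x ^ 2 * f x, x ^ 2 * deriv f x]

/-- The mean vector `μ_Z = E[Z]` of `Z = steinVec f X` for `X ∼ IG(μ, lam)`. -/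
def steinMean (μ lam : ℝ) (f : ℝ → ℝ) : Fin 5 → ℝ :=
  fun j => ∫ x, steinVec f x j ∂(igMeasure μ lam)

/-- The vector of sample means of the five statistics. -/
def steinSampleMean {Ω : Type*} (f : ℝ → ℝ) (X : ℕ → Ω → ℝ) (n : ℕ) (ω : Ω) : Fin 5 → ℝ :=
  fun j => sampleMean X (fun x => steinVec f x j) n ω

/-- The function through which the estimator depends on the five sample means. -/
def steinG (x : Fin 5 → ℝ) : ℝ :=
  x 0 ^ 2 * (2 * x 4 + x 2) / (x 3 - x 0 ^ 2 * x 1)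

/-- The second-order Taylor polynomial of `h ↦ g (a + h) - g a`, that is `g'(a) h + g''(a)(h,h) / 2`. -/
def taylorTwo {E : Type*} [NormedAddCommGroup E] [NormedSpace ℝ E] (g : E → ℝ) (a h : E) : ℝ :=
  fderiv ℝ g a h + (1 / 2) * fderiv ℝ (fderiv ℝ g) a h h

/-- The second-order Taylor approximation of the estimation error `steinMM f X n - lam`. -/
def steinTaylor {Ω : Type*} (μ lam : ℝ) (f : ℝ → ℝ) (X : ℕ → Ω → ℝ) (n : ℕ) (ω : Ω) : ℝ :=
  taylorTwo steinG (steinMean μ lam f) (steinSampleMean f X n ω - steinMean μ lam f)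

/-- The asymptotic variance of the Stein-MM estimator for sample size `n`. -/
def igAsympVar (μ lam : ℝ) (f : ℝ → ℝ) (n : ℕ) : ℝ :=
  let M := igMoment μ lam f
  let θ := igTheta μ lam f
  (1 / (n : ℝ)) *
    (μ ^ 4 / θ ^ 2 *
        (M 2 2 0 - M 1 1 0 * (lam * θ / μ ^ 2 + 2 * M 2 0 1) + 4 * M 3 1 1 + 4 * M 4 0 2
          - 4 * M 2 0 1 ^ 2)
      + 2 * lam * μ / θ ^ 2 *
        (μ ^ 3 * (M 1 2 0 + 2 * M 2 1 1 - lam * θ / μ ^ 2 * M 0 1 0)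
          - μ * (M 3 2 0 + 2 * M 4 1 1)
          + M 2 1 0 * (4 * M 2 1 0 + 4 * M 3 0 1 - lam * θ / μ))
      + lam ^ 2 / (μ * θ ^ 2) *
        (μ ^ 5 * M 0 2 0 + μ ^ 3 * M 0 1 0 * (θ + M 2 1 0) - 2 * μ ^ 3 * M 2 2 0
          + 4 * M 2 1 0 * (μ ^ 2 * M 1 1 0 - μ ^ 3 * M 0 1 0 - M 3 1 0)
          + μ * (3 * M 2 1 0 ^ 2 + M 4 2 0)))

/-- The asymptotic bias of the Stein-MM estimator for sample size `n`. -/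
def igAsympBias (μ lam : ℝ) (f : ℝ → ℝ) (n : ℕ) : ℝ :=
  let M := igMoment μ lam f
  let θ := igTheta μ lam f
  (1 / (n : ℝ)) *
    (1 / (μ * θ ^ 2) *
        (μ ^ 2 * M 2 1 0 * (M 2 1 0 + 3 * μ ^ 2 * M 0 1 0)
          + lam * (μ ^ 5 * M 0 2 0 + μ * M 4 2 0 - 2 * M 3 1 0 * M 2 1 0
            + 4 * μ ^ 2 * M 1 1 0 * M 2 1 0 - 2 * μ ^ 3 * M 2 2 0))
      + μ / θ ^ 3 *
        (M 2 1 0 * (2 * M 2 1 0 ^ 2 - μ * M 3 2 0 + 4 * M 2 1 0 * M 3 0 1 - 2 * μ * M 4 1 1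
            + μ ^ 3 * (M 1 2 0 + 2 * M 2 1 1))
          - μ ^ 2 * M 0 1 0 *
            (2 * M 3 1 0 * (2 * M 2 0 1 + M 1 1 0) + 2 * M 2 1 0 ^ 2 + 4 * M 2 1 0 * M 3 0 1
              + μ ^ 3 * (M 1 2 0 + 2 * M 2 1 1) - μ * (M 3 2 0 + 2 * M 4 1 1))))

end

/-! The engine is the Stein identity E[2X²w' + Xw − (λ/μ²)(X² − μ²)w] = 0, obtained by integrating
the derivative of 2x²w(x)φ(x) over (0, ∞) (`igMeasure_stein`). With w = f it says g(μ_Z) = λ; with w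
= 1 and w = 1/x it gives E[X²] and E[1/X].

Since ϑ_f ≠ 0, g is smooth near μ_Z, and the rest is the delta method. The centred sample means have
covariance Σ/n, where Σ is the covariance matrix of Z, so by Markov's inequality they have size
O_P(n^(-1/2)). The first-order Taylor remainder is then o_P(n^(-1/2)), and the central limit theorem
for the scalar score Dg(μ_Z)(Z − μ_Z) gives normality with variance ∇gᵀΣ∇g/n. The second-order
remainder is o_P(1/n), and E[T_n] is half the Hessian of g contracted with Σ/n, the linear term
having mean zero. The displayed formulas equal these expressions modulo the definition of ϑ_f and
the moment equation E[2X²f' + Xf] = λϑ_f/μ² (`igAsympVar_eq_sum`, `igAsympBias_eq_sum`).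

The delicate point is positivity of the variance (`not_ae_steinScore_eq_zero`). If the score
vanished almost surely, f would satisfy Af = −c(x − μ) almost everywhere, with A the Stein operator
above. For p = x + μ²/x one has A(fp) = p·Af + 2(x² − μ²)f. Taking expectations, the left side is 0
and E[p(X)(X − μ)] = 0, so 2ϑ_f = 0, a contradiction. -/

/-! ### The density and integration against it -/

lemma igPDF_of_pos {μ lam x : ℝ} (hx : 0 < x) :
    igPDF μ lam x = Real.sqrt (lam / (2 * Real.pi)) * Real.exp (lam / μ) * x ^ (-(3 / 2) : ℝ) *
      Real.exp (-(lam / (2 * μ)) * (x / μ + μ / x)) := by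
  simp [igPDF, hx]

lemma igPDF_nonneg (μ lam x : ℝ) : 0 ≤ igPDF μ lam x := by
  unfold igPDF
  split_ifs with hx
  · positivity
  · rfl

lemma igPDF_pos {μ lam x : ℝ} (hlam : 0 < lam) (hx : 0 < x) : 0 < igPDF μ lam x := by
  rw [igPDF_of_pos hx]
  have : 0 < Real.sqrt (lam / (2 * Real.pi)) := Real.sqrt_pos.2 (by positivity)
  positivity

lemma measurable_igPDF (μ lam : ℝ) : Measurable (igPDF μ lam) := by
  unfold igPDF
  exact Measurable.ite measurableSet_Ioi (by fun_prop) measurable_const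

/-- The density is nonzero exactly on the positive half-line. -/
lemma ae_igMeasure_iff {μ lam : ℝ} (hlam : 0 < lam) {p : ℝ → Prop} :
    (∀ᵐ x ∂(igMeasure μ lam), p x) ↔ ∀ᵐ x, 0 < x → p x := by
  rw [igMeasure, ae_withDensity_iff (measurable_igPDF μ lam).ennreal_ofReal]
  refine eventually_congr (Eventually.of_forall fun x => ?_)
  have : ENNReal.ofReal (igPDF μ lam x) ≠ 0 ↔ 0 < x := by
    rw [Ne, ENNReal.ofReal_eq_zero, not_le]
    refine ⟨fun h => ?_, igPDF_pos hlam⟩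
    by_contra hx
    simp [igPDF, hx] at h
  rw [this]

lemma ae_pos_igMeasure {μ lam : ℝ} (hlam : 0 < lam) : ∀ᵐ x ∂(igMeasure μ lam), 0 < x :=
  (ae_igMeasure_iff hlam).2 (by simp)

lemma mul_igPDF_eq_indicator (μ lam : ℝ) (h : ℝ → ℝ) :
    (fun x => h x * igPDF μ lam x) = (Ioi 0).indicator (fun x => h x * igPDF μ lam x) := by
  ext x
  by_cases hx : 0 < x
  · simp [hx]
  · simp [hx, igPDF]

lemma integrable_igMeasure_iff {μ lam : ℝ} {h : ℝ → ℝ} :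
    Integrable h (igMeasure μ lam) ↔ IntegrableOn (fun x => h x * igPDF μ lam x) (Ioi 0) := by
  rw [igMeasure, integrable_withDensity_iff (measurable_igPDF μ lam).ennreal_ofReal (by simp)]
  simp only [ENNReal.toReal_ofReal (igPDF_nonneg μ lam _)]
  conv_lhs => rw [mul_igPDF_eq_indicator, integrable_indicator_iff measurableSet_Ioi]

lemma integral_igMeasure (μ lam : ℝ) (h : ℝ → ℝ) :
    ∫ x, h x ∂(igMeasure μ lam) = ∫ x in Ioi 0, h x * igPDF μ lam x := by
  rw [igMeasure, integral_withDensity_eq_integral_toReal_smul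
    (measurable_igPDF μ lam).ennreal_ofReal (by simp)]
  simp only [ENNReal.toReal_ofReal (igPDF_nonneg μ lam _), smul_eq_mul, mul_comm (igPDF μ lam _)]
  conv_lhs => rw [mul_igPDF_eq_indicator, integral_indicator measurableSet_Ioi]

/-- The logarithmic derivative of the inverse Gaussian density. -/
lemma hasDerivAt_igPDF {μ lam x : ℝ} (hμ : 0 < μ) (hx : 0 < x) :
    HasDerivAt (igPDF μ lam)
      (igPDF μ lam x * (-(3 / (2 * x)) - lam / (2 * μ ^ 2) + lam / (2 * x ^ 2))) x := by
  have h1 : HasDerivAt (fun y : ℝ => y ^ (-(3 / 2) : ℝ)) (-(3 / 2) * x ^ (-(3 / 2) - 1 : ℝ)) x :=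
    Real.hasDerivAt_rpow_const (Or.inl hx.ne')
  have h2 : HasDerivAt (fun y : ℝ => -(lam / (2 * μ)) * (y / μ + μ / y))
      (-(lam / (2 * μ)) * (1 / μ + (0 * x - μ * 1) / x ^ 2)) x :=
    (((hasDerivAt_id x).div_const μ).add
      ((hasDerivAt_const x μ).div (hasDerivAt_id x) hx.ne')).const_mul _
  have h3 := (h1.const_mul (Real.sqrt (lam / (2 * Real.pi)) * Real.exp (lam / μ))).mul h2.exp
  have h4 : HasDerivAt (igPDF μ lam) _ x := h3.congr_of_eventuallyEq (by
    filter_upwards [Ioi_mem_nhds hx] with y hy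
    rw [igPDF_of_pos hy]; rfl)
  refine h4.congr_deriv ?_
  rw [igPDF_of_pos hx, Real.rpow_sub_one hx.ne']
  field_simp
  ring

/-! ### Density bounds and integrability of powers -/

lemma exp_neg_le_two_div_sq {y : ℝ} (hy : 0 < y) : Real.exp (-y) ≤ 2 / y ^ 2 := by
  rw [Real.exp_neg, inv_le_comm₀ (Real.exp_pos _) (by positivity)]
  have := Real.quadratic_le_exp_of_nonneg hy.le
  rw [inv_div]
  linarith

/-- Discards the factor exp(−λ/(2x)) ≤ 1; sharp enough for positive powers of x. -/
lemma igPDF_le_rpow_mul_exp {μ lam x : ℝ} (hμ : 0 < μ) (hlam : 0 < lam) (hx : 0 < x) :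
    igPDF μ lam x ≤ Real.sqrt (lam / (2 * Real.pi)) * Real.exp (lam / μ) *
      (x ^ (-(3 / 2) : ℝ) * Real.exp (-(lam / (2 * μ ^ 2)) * x)) := by
  rw [igPDF_of_pos hx, mul_assoc]
  refine mul_le_mul_of_nonneg_left (mul_le_mul_of_nonneg_left (Real.exp_le_exp.2 ?_)
    (by positivity)) (by positivity)
  have : 0 < lam / (2 * x) := by positivity
  have e : -(lam / (2 * μ)) * (x / μ + μ / x) = -(lam / (2 * μ ^ 2)) * x - lam / (2 * x) := by
    field_simp
    ring
  linarith

/-- Trades exp(−λ/(2x)) for 8x²/λ², which turns the singular x^(-3/2) into x^(1/2). This controls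
1/x near 0 and shows that the density vanishes there. -/
lemma igPDF_le_rpow_mul_exp' {μ lam x : ℝ} (hμ : 0 < μ) (hlam : 0 < lam) (hx : 0 < x) :
    igPDF μ lam x ≤ Real.sqrt (lam / (2 * Real.pi)) * Real.exp (lam / μ) * (8 / lam ^ 2) *
      (x ^ (1 / 2 : ℝ) * Real.exp (-(lam / (2 * μ ^ 2)) * x)) := by
  have e : -(lam / (2 * μ)) * (x / μ + μ / x) = -(lam / (2 * μ ^ 2)) * x + -(lam / (2 * x)) := by
    field_simp
    ring
  have e2 : x ^ (1 / 2 : ℝ) = x ^ (-(3 / 2) : ℝ) * x ^ 2 := by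
    rw [← Real.rpow_add_natCast hx.ne']; norm_num
  rw [igPDF_of_pos hx, e, Real.exp_add, e2]
  calc _ ≤ Real.sqrt (lam / (2 * Real.pi)) * Real.exp (lam / μ) * x ^ (-(3 / 2) : ℝ) *
      (Real.exp (-(lam / (2 * μ ^ 2)) * x) * (2 / (lam / (2 * x)) ^ 2)) := by
        gcongr
        exact exp_neg_le_two_div_sq (by positivity)
    _ = _ := by
        field_simp
        ring

lemma integrableOn_rpow_mul_exp {s b : ℝ} (hs : -1 < s) (hb : 0 < b) :
    IntegrableOn (fun x : ℝ => x ^ s * Real.exp (-b * x)) (Ioi 0) := by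
  simpa using integrableOn_rpow_mul_exp_neg_mul_rpow hs one_pos hb

lemma integrable_sq_igMeasure {μ lam : ℝ} (hμ : 0 < μ) (hlam : 0 < lam) :
    Integrable (fun x => x ^ 2) (igMeasure μ lam) := by
  rw [integrable_igMeasure_iff]
  refine Integrable.mono' ((integrableOn_rpow_mul_exp (s := 1 / 2) (b := lam / (2 * μ ^ 2))
    (by norm_num) (by positivity)).const_mul (Real.sqrt (lam / (2 * Real.pi)) * Real.exp (lam / μ)))
    ((measurable_id.pow_const 2).mul (measurable_igPDF μ lam)).aestronglyMeasurable ?_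
  filter_upwards [self_mem_ae_restrict measurableSet_Ioi] with x (hx : 0 < x)
  have e2 : x ^ (1 / 2 : ℝ) = x ^ (-(3 / 2) : ℝ) * x ^ 2 := by
    rw [← Real.rpow_add_natCast hx.ne']; norm_num
  rw [Real.norm_of_nonneg (mul_nonneg (by positivity) (igPDF_nonneg _ _ _)), e2]
  calc _ ≤ x ^ 2 * _ := mul_le_mul_of_nonneg_left (igPDF_le_rpow_mul_exp hμ hlam hx) (by positivity)
    _ = _ := by ring

lemma integrable_inv_igMeasure {μ lam : ℝ} (hμ : 0 < μ) (hlam : 0 < lam) :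
    Integrable (fun x => x⁻¹) (igMeasure μ lam) := by
  rw [integrable_igMeasure_iff]
  refine Integrable.mono' ((integrableOn_rpow_mul_exp (s := -(1 / 2)) (b := lam / (2 * μ ^ 2))
    (by norm_num) (by positivity)).const_mul
    (Real.sqrt (lam / (2 * Real.pi)) * Real.exp (lam / μ) * (8 / lam ^ 2)))
    (measurable_id.inv.mul (measurable_igPDF μ lam)).aestronglyMeasurable ?_
  filter_upwards [self_mem_ae_restrict measurableSet_Ioi] with x (hx : 0 < x)
  have e2 : x ^ (1 / 2 : ℝ) = x ^ (-(1 / 2) : ℝ) * x := by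
    rw [← Real.rpow_add_one hx.ne']; norm_num
  rw [Real.norm_of_nonneg (mul_nonneg (by positivity) (igPDF_nonneg _ _ _))]
  calc _ ≤ x⁻¹ * _ := mul_le_mul_of_nonneg_left (igPDF_le_rpow_mul_exp' hμ hlam hx) (by positivity)
    _ = _ := by
      rw [e2]
      field_simp

lemma tendsto_igPDF_zero {μ lam : ℝ} (hμ : 0 < μ) (hlam : 0 < lam) :
    Tendsto (igPDF μ lam) (𝓝[>] 0) (𝓝 0) := by
  have h : Tendsto (fun x : ℝ => Real.sqrt (lam / (2 * Real.pi)) * Real.exp (lam / μ) *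
      (8 / lam ^ 2) * (x ^ (1 / 2 : ℝ) * Real.exp (-(lam / (2 * μ ^ 2)) * x))) (𝓝[>] 0) (𝓝 0) := by
    have : Continuous (fun x : ℝ => Real.sqrt (lam / (2 * Real.pi)) * Real.exp (lam / μ) *
      (8 / lam ^ 2) * (x ^ (1 / 2 : ℝ) * Real.exp (-(lam / (2 * μ ^ 2)) * x))) :=
      continuous_const.mul ((Real.continuous_rpow_const (by norm_num)).mul (by fun_prop))
    simpa using (this.tendsto 0).mono_left nhdsWithin_le_nhds
  refine tendsto_of_tendsto_of_tendsto_of_le_of_le' tendsto_const_nhds h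
    (Eventually.of_forall fun x => igPDF_nonneg μ lam x) ?_
  filter_upwards [self_mem_nhdsWithin] with x hx
  exact igPDF_le_rpow_mul_exp' hμ hlam hx

/-! ### Stein identity and the moments of orders 1, 2 and −1 -/

/-- The Stein identity of the inverse Gaussian distribution. -/
lemma igMeasure_stein {μ lam : ℝ} (hμ : 0 < μ) {w w' : ℝ → ℝ}
    (hw : ∀ x, 0 < x → HasDerivAt w (w' x) x)
    (h0 : Tendsto (fun x => x ^ 2 * w x * igPDF μ lam x) (𝓝[>] 0) (𝓝 0))
    (hi₁ : Integrable (fun x => x ^ 2 * w x) (igMeasure μ lam))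
    (hi₂ : Integrable (fun x => 2 * x ^ 2 * w' x + x * w x
      - lam / μ ^ 2 * (x ^ 2 - μ ^ 2) * w x) (igMeasure μ lam)) :
    ∫ x, (2 * x ^ 2 * w' x + x * w x
      - lam / μ ^ 2 * (x ^ 2 - μ ^ 2) * w x) ∂(igMeasure μ lam) = 0 := by
  rw [integrable_igMeasure_iff] at hi₁ hi₂
  rw [integral_igMeasure]
  set F := fun x => x ^ 2 * w x * igPDF μ lam x with hF
  set F' := fun x => (2 * x ^ 2 * w' x + x * w x
      - lam / μ ^ 2 * (x ^ 2 - μ ^ 2) * w x) * igPDF μ lam x with hF'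
  have hd : ∀ x ∈ Ioi (0 : ℝ), HasDerivAt (fun x => 2 * F x) (F' x) x := by
    intro x (hx : 0 < x)
    have := ((((hasDerivAt_id x).pow 2).mul (hw x hx)).mul
      (hasDerivAt_igPDF (lam := lam) hμ hx)).const_mul 2
    refine this.congr_deriv ?_
    simp only [hF', id, Pi.mul_apply, Pi.pow_apply]
    field_simp
    ring
  -- Integrability of `F` and of its derivative forces the limit 0 at infinity, so only the boundary
  -- at 0 needs an assumption.
  have htop : Tendsto (fun x => 2 * F x) atTop (𝓝 0) :=
    tendsto_zero_of_hasDerivAt_of_integrableOn_Ioi hd hi₂ (hi₁.const_mul 2)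
  have hz : Tendsto (fun x => 2 * F x) (𝓝[>] 0) (𝓝 0) := by simpa using h0.const_mul 2
  have key := integral_Ioi_deriv_mul_eq_sub (u := fun x => 2 * F x) (u' := F')
    (v := fun _ => (1 : ℝ)) (v' := fun _ => 0) (a := 0) (a' := 0) (b' := 0) hd
    (fun x _ => hasDerivAt_const x 1)
    (by convert! hi₂ using 1; ext x; simp)
    (by convert! hz using 1; ext x; simp) (by convert! htop using 1; ext x; simp)
  simpa using key

/-- The inverse Gaussian distribution has mean `μ`: the substitution `x ↦ μ ^ 2 / x`
exchanges total mass and first moment. -/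
lemma integral_id_igMeasure {μ lam : ℝ} (hμ : 0 < μ) [IsProbabilityMeasure (igMeasure μ lam)] :
    ∫ x, x ∂(igMeasure μ lam) = μ := by
  have h1 : ∫ x in Ioi 0, igPDF μ lam x = 1 := by
    have := integral_igMeasure μ lam (fun _ => 1)
    simpa using this.symm
  rw [integral_igMeasure]
  -- The substitution is composed of an inversion and a scaling by μ⁻². The exponent of φ is
  -- invariant under x ↦ μ²/x, and the Jacobian μ²/x² gives φ(μ²/x)·μ²/x² = xφ(x)/μ.
  have hinv := integral_comp_rpow_Ioi (igPDF μ lam) (p := -1) (by norm_num)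
  have hsc := integral_comp_mul_left_Ioi'
    (fun y => (|(-1 : ℝ)| * y ^ ((-1 : ℝ) - 1)) • igPDF μ lam (y ^ (-1 : ℝ))) 0
    (b := (μ ^ 2)⁻¹) (by positivity)
  rw [mul_zero, hinv, h1, smul_eq_mul, ← integral_const_mul] at hsc
  refine Eq.trans ?_ (mul_one μ)
  rw [← hsc, ← integral_const_mul]
  refine setIntegral_congr_fun measurableSet_Ioi fun x (hx : 0 < x) => ?_
  have hy : 0 < (μ ^ 2)⁻¹ * x := by positivity
  have hs : ((μ ^ 2)⁻¹ * x) ^ ((-1 : ℝ) - 1) = (μ ^ 2 / x) ^ 2 := by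
    rw [show ((-1 : ℝ) - 1) = -((2 : ℕ) : ℝ) by norm_num, Real.rpow_neg hy.le, Real.rpow_natCast]
    field_simp
  have hr : ((μ ^ 2)⁻¹ * x) ^ (-1 : ℝ) = μ ^ 2 / x := by
    rw [Real.rpow_neg_one]
    field_simp
  have hp : (μ ^ 2 / x) ^ (-(3 / 2) : ℝ) = μ⁻¹ ^ 3 * (x ^ 3 * x ^ (-(3 / 2) : ℝ)) := by
    rw [Real.div_rpow (by positivity) hx.le, ← Real.rpow_natCast_mul hμ.le,
      ← Real.rpow_natCast x, ← Real.rpow_add hx, div_eq_mul_inv, ← Real.rpow_neg hx.le,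
      ← Real.rpow_natCast, Real.inv_rpow hμ.le, ← Real.rpow_neg hμ.le]
    norm_num
  rw [hs, hr, igPDF_of_pos hx, igPDF_of_pos (by positivity), hp,
    show μ ^ 2 / x / μ + μ / (μ ^ 2 / x) = x / μ + μ / x by field_simp; ring]
  simp only [abs_neg, abs_one, smul_eq_mul]
  field_simp

lemma integrable_id_igMeasure {μ lam : ℝ} (hμ : 0 < μ) (hlam : 0 < lam)
    [IsProbabilityMeasure (igMeasure μ lam)] : Integrable (fun x => x) (igMeasure μ lam) := by
  have : MemLp (fun x : ℝ => x) 2 (igMeasure μ lam) :=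
    (memLp_two_iff_integrable_sq measurable_id.aestronglyMeasurable).2
      (integrable_sq_igMeasure hμ hlam)
  exact this.integrable (by norm_num)

/-- The Stein identity with w = 1 reads E[X] = (λ/μ²)(E[X²] − μ²). -/
lemma integral_sq_igMeasure {μ lam : ℝ} (hμ : 0 < μ) (hlam : 0 < lam)
    [IsProbabilityMeasure (igMeasure μ lam)] :
    ∫ x, x ^ 2 ∂(igMeasure μ lam) = μ ^ 2 + μ ^ 3 / lam := by
  have hi := integrable_id_igMeasure hμ hlam
  have hi2 := integrable_sq_igMeasure hμ hlam
  have e : (fun x : ℝ => 2 * x ^ 2 * 0 + x * 1 - lam / μ ^ 2 * (x ^ 2 - μ ^ 2) * 1)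
      = fun x => x - lam / μ ^ 2 * (x ^ 2 - μ ^ 2) := by ext x; ring
  have hc : Integrable (fun x => lam / μ ^ 2 * (x ^ 2 - μ ^ 2)) (igMeasure μ lam) :=
    (hi2.sub (integrable_const _)).const_mul _
  have key := igMeasure_stein (lam := lam) hμ (w := fun _ => 1) (w' := fun _ => 0)
    (fun x _ => hasDerivAt_const x 1)
    (by
      have : Tendsto (fun x : ℝ => x ^ 2) (𝓝[>] 0) (𝓝 0) := by
        simpa using ((continuous_pow 2).tendsto (0 : ℝ)).mono_left nhdsWithin_le_nhds
      simpa using this.mul (tendsto_igPDF_zero hμ hlam))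
    (by simpa using hi2) (by rw [e]; exact hi.sub hc)
  rw [e, integral_sub hi hc, integral_const_mul, integral_sub hi2 (integrable_const _),
    integral_id_igMeasure hμ] at key
  simp only [integral_const, probReal_univ, smul_eq_mul, one_mul] at key
  field_simp at key ⊢
  linarith

/-- The Stein identity with w = 1/x reads −1 − (λ/μ²)(E[X] − μ²E[1/X]) = 0. The value is needed for
the positivity of the variance. -/
lemma integral_inv_igMeasure {μ lam : ℝ} (hμ : 0 < μ) (hlam : 0 < lam)
    [IsProbabilityMeasure (igMeasure μ lam)] :
    ∫ x, x⁻¹ ∂(igMeasure μ lam) = 1 / μ + 1 / lam := by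
  have hi := integrable_id_igMeasure hμ hlam
  have hi2 := integrable_inv_igMeasure hμ hlam
  have e : (fun x : ℝ => 2 * x ^ 2 * -(x ^ 2)⁻¹ + x * x⁻¹ - lam / μ ^ 2 * (x ^ 2 - μ ^ 2) * x⁻¹)
      =ᵐ[igMeasure μ lam] fun x => -1 - lam / μ ^ 2 * (x - μ ^ 2 * x⁻¹) := by
    filter_upwards [ae_pos_igMeasure hlam] with x hx
    field_simp
    ring
  have hc : Integrable (fun x => lam / μ ^ 2 * (x - μ ^ 2 * x⁻¹)) (igMeasure μ lam) :=
    (hi.sub (hi2.const_mul _)).const_mul _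
  have key := igMeasure_stein (lam := lam) hμ (w := fun x => x⁻¹) (w' := fun x => -(x ^ 2)⁻¹)
    (fun x hx => hasDerivAt_inv hx.ne')
    (by
      have : Tendsto (fun x : ℝ => x) (𝓝[>] 0) (𝓝 0) :=
        tendsto_id.mono_left nhdsWithin_le_nhds
      have := this.mul (tendsto_igPDF_zero hμ hlam)
      rw [mul_zero] at this
      refine this.congr' ?_
      filter_upwards [self_mem_nhdsWithin] with x (hx : 0 < x)
      field_simp)
    (hi.congr (by
      filter_upwards [ae_pos_igMeasure hlam] with x hx
      field_simp))
    (Integrable.congr ((integrable_const _).sub hc) e.symm)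
  rw [integral_congr_ae e, integral_sub (integrable_const _) hc, integral_const_mul,
    integral_sub hi (hi2.const_mul _), integral_const_mul, integral_id_igMeasure hμ] at key
  simp only [integral_const, probReal_univ, smul_eq_mul, one_mul] at key
  field_simp at key ⊢
  linarith

/-! ### Second-order Taylor expansion -/

section Taylor

variable {E : Type*} [NormedAddCommGroup E] [NormedSpace ℝ E]

lemma eventually_hasDerivAt_comp_line {g : E → ℝ} {a : E} (hg : ContDiffAt ℝ 2 g a) (h : E) :
    ∀ᶠ t : ℝ in 𝓝 0, HasDerivAt (fun s : ℝ => g (a + s • h)) (fderiv ℝ g (a + t • h) h) t := by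
  have hd : ∀ᶠ x in 𝓝 a, DifferentiableAt ℝ g x :=
    (hg.eventually (by simp)).mono fun x hx => hx.differentiableAt (by simp)
  have hc : Tendsto (fun t : ℝ => a + t • h) (𝓝 0) (𝓝 a) := by
    have : Continuous fun t : ℝ => a + t • h := by fun_prop
    simpa using this.tendsto 0
  filter_upwards [hc.eventually hd] with t ht
  have hl : HasDerivAt (fun s : ℝ => a + s • h) h t := by
    simpa using ((hasDerivAt_id t).smul_const h).const_add a
  exact ht.hasFDerivAt.comp_hasDerivAt t hl

lemma hasFDerivAt_fderiv {g : E → ℝ} {a : E} (hg : ContDiffAt ℝ 2 g a) :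
    HasFDerivAt (fderiv ℝ g) (fderiv ℝ (fderiv ℝ g) a) a :=
  ((hg.fderiv_right (m := 1) (by norm_num)).differentiableAt (by simp)).hasFDerivAt

lemma hasDerivAt_fderiv_comp_line {g : E → ℝ} {a : E} (hg : ContDiffAt ℝ 2 g a) (h : E) :
    HasDerivAt (fun s : ℝ => fderiv ℝ g (a + s • h) h) (fderiv ℝ (fderiv ℝ g) a h h) 0 := by
  have hl : HasDerivAt (fun s : ℝ => a + s • h) h 0 := by
    simpa using ((hasDerivAt_id (0 : ℝ)).smul_const h).const_add a
  have h2 : HasFDerivAt (fderiv ℝ g) (fderiv ℝ (fderiv ℝ g) a) (a + (0 : ℝ) • h) := by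
    simpa using hasFDerivAt_fderiv hg
  have h3 := h2.comp_hasDerivAt (0 : ℝ) hl
  exact h3.clm_apply (hasDerivAt_const (0 : ℝ) h) |>.congr_deriv (by simp)

/-- Taylor's theorem of second order with Peano remainder. -/
lemma exists_abs_sub_taylorTwo_le {g : E → ℝ} {a : E} (hg : ContDiffAt ℝ 2 g a) {c : ℝ}
    (hc : 0 < c) :
    ∃ δ > 0, ∀ h, ‖h‖ < δ → |g (a + h) - g a - taylorTwo g a h| ≤ c * ‖h‖ ^ 2 := by
  have hd : ∀ᶠ x in 𝓝 a, DifferentiableAt ℝ g x :=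
    (hg.eventually (by simp)).mono fun x hx => hx.differentiableAt (by simp)
  have h1 := (hasFDerivAt_fderiv hg).isLittleO.def hc
  obtain ⟨δ, hδ, H⟩ := Metric.eventually_nhds_iff_ball.1 (hd.and h1)
  refine ⟨δ, hδ, fun h hh => ?_⟩
  set B := fderiv ℝ (fderiv ℝ g) a
  -- Mean value inequality on [0, 1]: φ(1) − φ(0) is the remainder, and φ' is the first-order error
  -- of `fderiv ℝ g` at `a`, applied to `h`.
  set φ : ℝ → ℝ := fun t => g (a + t • h) - t * fderiv ℝ g a h - t ^ 2 / 2 * B h h with hφ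
  set φ' : ℝ → ℝ := fun t => fderiv ℝ g (a + t • h) h - fderiv ℝ g a h - t * B h h with hφ'
  have hmem : ∀ t ∈ Icc (0 : ℝ) 1, a + t • h ∈ Metric.ball a δ := by
    intro t ht
    rw [Metric.mem_ball, dist_self_add_left, norm_smul, Real.norm_of_nonneg ht.1]
    nlinarith [norm_nonneg h, ht.2]
  have hder : ∀ t ∈ Icc (0 : ℝ) 1, HasDerivWithinAt φ (φ' t) (Icc 0 1) t := by
    intro t ht
    have hl : HasDerivAt (fun s : ℝ => a + s • h) h t := by
      simpa using ((hasDerivAt_id t).smul_const h).const_add a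
    have h2 := (H _ (hmem t ht)).1.hasFDerivAt.comp_hasDerivAt t hl
    have h3 := (h2.sub ((hasDerivAt_id t).mul_const (fderiv ℝ g a h))).sub
      ((((hasDerivAt_id t).pow 2).div_const 2).mul_const (B h h))
    refine (h3.congr_deriv ?_).hasDerivWithinAt
    simp [hφ']
  have hbd : ∀ t ∈ Ico (0 : ℝ) 1, ‖φ' t‖ ≤ c * ‖h‖ ^ 2 := by
    intro t ht
    have h4 := (H _ (hmem t ⟨ht.1, ht.2.le⟩)).2
    rw [add_sub_cancel_left] at h4
    have e : φ' t = (fderiv ℝ g (a + t • h) - fderiv ℝ g a - B (t • h)) h := by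
      simp [hφ']
    rw [e]
    refine (ContinuousLinearMap.le_opNorm _ _).trans ?_
    calc _ ≤ c * ‖t • h‖ * ‖h‖ := by gcongr
      _ = t * (c * ‖h‖ ^ 2) := by rw [norm_smul, Real.norm_of_nonneg ht.1]; ring
      _ ≤ 1 * (c * ‖h‖ ^ 2) := by gcongr; exact ht.2.le
      _ = _ := one_mul _
  have := norm_image_sub_le_of_norm_deriv_le_segment_01' hder hbd
  rw [Real.norm_eq_abs] at this
  convert! this using 2
  simp [hφ, taylorTwo, B]
  ring

end Taylor

/-! ### First and second derivatives of g -/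

/-- The linear part of `steinG` at `a`. -/
noncomputable def steinGFst (a h : Fin 5 → ℝ) : ℝ :=
  (a 0 ^ 2 * (2 * h 4 + h 2) + 2 * a 0 * (2 * a 4 + a 2) * h 0
    - steinG a * (h 3 - a 0 ^ 2 * h 1 - 2 * a 0 * a 1 * h 0)) / (a 3 - a 0 ^ 2 * a 1)

/-- The quadratic part of `steinG` at `a`. -/
noncomputable def steinGSnd (a h : Fin 5 → ℝ) : ℝ :=
  (2 * a 0 * h 0 * (2 * h 4 + h 2) + h 0 ^ 2 * (2 * a 4 + a 2)
    + steinG a * (2 * a 0 * h 0 * h 1 + h 0 ^ 2 * a 1)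
    - steinGFst a h * (h 3 - a 0 ^ 2 * h 1 - 2 * a 0 * a 1 * h 0)) / (a 3 - a 0 ^ 2 * a 1)

lemma contDiffAt_steinG {a : Fin 5 → ℝ} (ha : a 3 - a 0 ^ 2 * a 1 ≠ 0) :
    ContDiffAt ℝ 2 steinG a := by
  unfold steinG
  exact ContDiffAt.div (by fun_prop) (by fun_prop) ha

/-- On the line a + th the function is a quotient N/D of polynomials in t, so both derivatives come
from one-variable calculus. The factor 2 appears because `steinGSnd` is the Taylor coefficient, half
the second derivative. -/
lemma steinG_line {a : Fin 5 → ℝ} (ha : a 3 - a 0 ^ 2 * a 1 ≠ 0) (h : Fin 5 → ℝ) :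
    fderiv ℝ steinG a h = steinGFst a h ∧
      fderiv ℝ (fderiv ℝ steinG) a h h = 2 * steinGSnd a h := by
  have hg := contDiffAt_steinG ha
  set N : ℝ → ℝ := fun t => (a 0 + t * h 0) ^ 2 * (2 * (a 4 + t * h 4) + (a 2 + t * h 2)) with hN
  set D : ℝ → ℝ := fun t => (a 3 + t * h 3) - (a 0 + t * h 0) ^ 2 * (a 1 + t * h 1) with hD
  set N' : ℝ → ℝ := fun t => 2 * (a 0 + t * h 0) * h 0 * (2 * (a 4 + t * h 4) + (a 2 + t * h 2))
    + (a 0 + t * h 0) ^ 2 * (2 * h 4 + h 2) with hN'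
  set D' : ℝ → ℝ := fun t => h 3 - (2 * (a 0 + t * h 0) * h 0 * (a 1 + t * h 1)
    + (a 0 + t * h 0) ^ 2 * h 1) with hD'
  have lin : ∀ i t, HasDerivAt (fun s : ℝ => a i + s * h i) (h i) t := fun i t => by
    simpa using ((hasDerivAt_id t).mul_const (h i)).const_add (a i)
  have dN : ∀ t, HasDerivAt N (N' t) t := fun t =>
    (((lin 0 t).pow 2).mul (((lin 4 t).const_mul 2).add (lin 2 t))).congr_deriv (by
      simp [hN'])
  have dD : ∀ t, HasDerivAt D (D' t) t := fun t =>
    ((lin 3 t).sub (((lin 0 t).pow 2).mul (lin 1 t))).congr_deriv (by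
      simp [hD'])
  have dN' : HasDerivAt N' (2 * h 0 * h 0 * (2 * a 4 + a 2)
      + 2 * a 0 * h 0 * (2 * h 4 + h 2) + 2 * a 0 * h 0 * (2 * h 4 + h 2)) 0 :=
    (((((lin 0 0).const_mul 2).mul_const (h 0)).mul (((lin 4 0).const_mul 2).add (lin 2 0))).add
      (((lin 0 0).pow 2).mul_const (2 * h 4 + h 2))).congr_deriv (by simp)
  have dD' : HasDerivAt D' (-(2 * h 0 * h 0 * a 1
      + 2 * a 0 * h 0 * h 1 + 2 * a 0 * h 0 * h 1)) 0 :=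
    ((((((lin 0 0).const_mul 2).mul_const (h 0)).mul (lin 1 0)).add
      (((lin 0 0).pow 2).mul_const (h 1))).const_sub (h 3)).congr_deriv (by simp)
  have hF : (fun s : ℝ => steinG (a + s • h)) = fun s => N s / D s := by
    ext s; simp [steinG, hN, hD]
  have hD0 : D 0 ≠ 0 := by simpa [hD] using ha
  have hDne : ∀ᶠ t in 𝓝 (0 : ℝ), D t ≠ 0 := (dD 0).continuousAt.eventually_ne hD0
  -- Equality near 0, not just at 0, so that it can be differentiated once more.
  have key : (fun t : ℝ => fderiv ℝ steinG (a + t • h) h) =ᶠ[𝓝 0]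
      fun t => (N' t * D t - N t * D' t) / D t ^ 2 := by
    filter_upwards [eventually_hasDerivAt_comp_line hg h, hDne] with t h1 h2
    rw [hF] at h1
    exact h1.unique ((dN t).div (dD t) h2)
  constructor
  · have := key.self_of_nhds
    simp only [zero_smul, add_zero] at this
    rw [this]
    simp only [hN, hD, hN', hD', steinGFst, steinG, zero_mul, add_zero]
    field_simp
    ring
  · have h1 := (hasDerivAt_fderiv_comp_line hg h).congr_of_eventuallyEq key.symm
    have h2 := ((dN'.mul (dD 0)).sub ((dN 0).mul dD')).div ((dD 0).pow 2) (pow_ne_zero 2 hD0)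
    rw [h1.unique h2]
    simp only [hN, hD, hN', hD', steinGSnd, steinGFst, steinG, zero_mul, add_zero, Pi.mul_apply,
      Pi.sub_apply, Pi.pow_apply]
    field_simp
    ring

lemma taylorTwo_steinG {a : Fin 5 → ℝ} (ha : a 3 - a 0 ^ 2 * a 1 ≠ 0) (h : Fin 5 → ℝ) :
    taylorTwo steinG a h = steinGFst a h + steinGSnd a h := by
  rw [taylorTwo, (steinG_line ha h).1, (steinG_line ha h).2]
  ring

/-! ### First and second moments of sample means -/

section SampleMean

variable {Ω : Type*} [MeasurableSpace Ω] {P : Measure Ω} {ν : Measure ℝ} {X : ℕ → Ω → ℝ}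

lemma ProbabilityTheory.HasLaw.memLp_comp {Y : Ω → ℝ} (hY : HasLaw Y ν P) {p : ℝ → ℝ}
    (hp : MemLp p 2 ν) : MemLp (fun ω => p (Y ω)) 2 P := by
  have hp' : MemLp p 2 (P.map Y) := hY.map_eq ▸ hp
  exact hp'.comp_of_map hY.aemeasurable

lemma aemeasurable_sampleMean (hlaw : ∀ i, HasLaw (X i) ν P) {p : ℝ → ℝ} (hp : AEMeasurable p ν)
    (n : ℕ) : AEMeasurable (sampleMean X p n) P := by
  unfold sampleMean
  refine AEMeasurable.const_mul (Finset.aemeasurable_fun_sum _ fun i _ => ?_) _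
  have hp' : AEMeasurable p (P.map (X i)) := (hlaw i).map_eq ▸ hp
  exact hp'.comp_aemeasurable (hlaw i).aemeasurable

lemma memLp_sampleMean (hlaw : ∀ i, HasLaw (X i) ν P) {p : ℝ → ℝ} (hp : MemLp p 2 ν)
    (n : ℕ) : MemLp (sampleMean X p n) 2 P := by
  have h : MemLp (fun ω => ∑ i ∈ Finset.range n, p (X i ω)) 2 P :=
    memLp_finsetSum _ fun i _ => (hlaw i).memLp_comp hp
  exact h.const_mul (1 / (n : ℝ))

lemma integral_sampleMean [IsProbabilityMeasure P] (hlaw : ∀ i, HasLaw (X i) ν P) {p : ℝ → ℝ}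
    (hp : MemLp p 2 ν) {n : ℕ} (hn : 0 < n) :
    ∫ ω, sampleMean X p n ω ∂P = ∫ x, p x ∂ν := by
  unfold sampleMean
  rw [integral_const_mul, integral_finsetSum _
    fun i _ => ((hlaw i).memLp_comp hp).integrable (by norm_num)]
  have : ∀ i, ∫ ω, p (X i ω) ∂P = ∫ x, p x ∂ν := fun i =>
    (hlaw i).integral_comp hp.aestronglyMeasurable
  simp only [this, Finset.sum_const, Finset.card_range, nsmul_eq_mul]
  have : (n : ℝ) ≠ 0 := by positivity
  field_simp

/-- Products of sample means of centred square-integrable statistics. -/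
lemma integral_sampleMean_mul [IsProbabilityMeasure P] (hlaw : ∀ i, HasLaw (X i) ν P)
    (hindep : iIndepFun X P) {p q : ℝ → ℝ} (hp : MemLp p 2 ν) (hq : MemLp q 2 ν)
    (hp0 : ∫ x, p x ∂ν = 0) {n : ℕ} (hn : 0 < n) :
    ∫ ω, sampleMean X p n ω * sampleMean X q n ω ∂P = (∫ x, p x * q x ∂ν) / n := by
  have hpX := fun i => (hlaw i).memLp_comp hp
  have hqX := fun i => (hlaw i).memLp_comp hq
  have hint : ∀ i j, Integrable (fun ω => p (X i ω) * q (X j ω)) P := fun i j =>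
    (hpX i).integrable_mul (hqX j)
  -- Off the diagonal, independence factors the expectation; centring of `p` alone makes it vanish.
  have hmom : ∀ i j, ∫ ω, p (X i ω) * q (X j ω) ∂P = if i = j then ∫ x, p x * q x ∂ν else 0 := by
    intro i j
    split_ifs with h
    · subst h
      exact (hlaw i).integral_comp (f := fun x => p x * q x)
        (hp.aestronglyMeasurable.mul hq.aestronglyMeasurable)
    · have hpm : AEMeasurable p (P.map (X i)) := (hlaw i).map_eq ▸ hp.aestronglyMeasurable.aemeasurable
      have hqm : AEMeasurable q (P.map (X j)) := (hlaw j).map_eq ▸ hq.aestronglyMeasurable.aemeasurable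
      have hi : IndepFun (p ∘ X i) (q ∘ X j) P := (hindep.indepFun h).comp₀ (hlaw i).aemeasurable
        (hlaw j).aemeasurable hpm hqm
      have e := hi.integral_fun_mul_eq_mul_integral (hpX i).aestronglyMeasurable
        (hqX j).aestronglyMeasurable
      rw [(hlaw i).integral_comp hp.aestronglyMeasurable, hp0, zero_mul] at e
      exact e
  have e : (fun ω => sampleMean X p n ω * sampleMean X q n ω) = fun ω =>
      (1 / (n : ℝ)) ^ 2 *
        ∑ i ∈ Finset.range n, ∑ j ∈ Finset.range n, p (X i ω) * q (X j ω) := by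
    ext ω
    rw [← Finset.sum_mul_sum]
    simp only [sampleMean]
    ring
  rw [e, integral_const_mul, integral_finsetSum _ fun i _ => integrable_finsetSum _
    fun j _ => hint i j]
  simp only [integral_finsetSum _ fun j _ => hint _ j, hmom]
  rw [Finset.sum_congr rfl fun i hi => by rw [Finset.sum_ite_eq, if_pos hi]]
  simp only [Finset.sum_const, Finset.card_range, nsmul_eq_mul]
  have : (n : ℝ) ≠ 0 := by positivity
  field_simp

end SampleMean

/-! ### Remainders in probability -/

section Remainder

variable {Ω : Type*} [MeasurableSpace Ω] {P : Measure Ω} [IsProbabilityMeasure P]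
  {E : Type*} [NormedAddCommGroup E]

/-- Either `H` leaves the δ-ball, or the quadratic bound applies and forces ‖H‖² ≥ ε/(ac); the tail
bound handles both events. -/
lemma measureReal_abs_remainder_ge_le {H : Ω → E} {r : E → ℝ} {c δ ε a K : ℝ} (hc : 0 < c)
    (hδ : 0 < δ) (hε : 0 < ε) (ha : 0 < a) (hr : ∀ h, ‖h‖ < δ → |r h| ≤ c * ‖h‖ ^ 2)
    (hH : ∀ t > 0, P.real {ω | t ≤ ‖H ω‖ ^ 2} ≤ K / t) :
    P.real {ω | ε ≤ |a * r (H ω)|} ≤ K / δ ^ 2 + K / (ε / (a * c)) := by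
  have hsub : {ω | ε ≤ |a * r (H ω)|} ⊆
      {ω | δ ^ 2 ≤ ‖H ω‖ ^ 2} ∪ {ω | ε / (a * c) ≤ ‖H ω‖ ^ 2} := by
    intro ω (hω : ε ≤ |a * r (H ω)|)
    by_cases h : ‖H ω‖ < δ
    · right
      change ε / (a * c) ≤ ‖H ω‖ ^ 2
      rw [div_le_iff₀ (by positivity)]
      rw [abs_mul, abs_of_pos ha] at hω
      calc ε ≤ a * |r (H ω)| := hω
        _ ≤ a * (c * ‖H ω‖ ^ 2) := by gcongr; exact hr _ h
        _ = _ := by ring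
    · left
      change δ ^ 2 ≤ ‖H ω‖ ^ 2
      have := not_lt.1 h
      gcongr
  calc _ ≤ _ := measureReal_mono hsub
    _ ≤ _ := measureReal_union_le _ _
    _ ≤ _ := add_le_add (hH _ (by positivity)) (hH _ (by positivity))

/-- A remainder of order `o(‖h‖ ^ 2)` at arguments of size `O_P(n ^ (-1 / 2))` is `o_P(1 / n)`. -/
lemma tendstoInMeasure_mul_remainder {H : ℕ → Ω → E} {r : E → ℝ} {K : ℝ}
    (hr : ∀ c > 0, ∃ δ > 0, ∀ h, ‖h‖ < δ → |r h| ≤ c * ‖h‖ ^ 2)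
    (hH : ∀ n : ℕ, 0 < n → ∀ t > 0, P.real {ω | t ≤ ‖H n ω‖ ^ 2} ≤ K / n / t) :
    TendstoInMeasure P (fun (n : ℕ) ω => (n : ℝ) * r (H n ω)) atTop (fun _ => 0) := by
  have hK : 0 ≤ K := by
    have := (measureReal_nonneg).trans (hH 1 one_pos 1 one_pos)
    simpa using this
  rw [tendstoInMeasure_iff_measureReal_norm]
  intro ε hε
  simp only [sub_zero, Real.norm_eq_abs]
  rw [Metric.tendsto_atTop]
  intro η hη
  -- With this constant the second tail term is (K/(K + 1))·η/2 for every n; K + 1 avoids dividing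
  -- by K = 0. The first term is below η/2 for large n.
  obtain ⟨δ, hδ, hrδ⟩ := hr (ε * η / (2 * (K + 1))) (by positivity)
  have ht : Tendsto (fun n : ℕ => K / δ ^ 2 / (n : ℝ)) atTop (𝓝 0) :=
    tendsto_const_div_atTop_nhds_zero_nat _
  obtain ⟨N, hN⟩ := Metric.tendsto_atTop.1 ht (η / 2) (by positivity)
  refine ⟨N + 1, fun n hn => ?_⟩
  have hn0 : 0 < n := by omega
  have hn1 : (0 : ℝ) < n := by exact_mod_cast hn0
  have h1 := measureReal_abs_remainder_ge_le (P := P) (K := K / n) (by positivity) hδ hε hn1 hrδ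
    (hH n hn0)
  have h2 := hN n (by omega)
  rw [Real.dist_eq, sub_zero, abs_of_nonneg (by positivity)] at h2 ⊢
  have h3 : K / n / (ε / (n * (ε * η / (2 * (K + 1))))) = K / (K + 1) * (η / 2) := by
    field_simp
  have h4 : K / (K + 1) ≤ 1 := by
    rw [div_le_one (by positivity)]; linarith
  have h5 : K / n / δ ^ 2 = K / δ ^ 2 / n := div_right_comm _ _ _
  rw [h3, h5] at h1
  nlinarith

/-- A remainder of order `O(‖h‖ ^ 2)` at arguments of size `O_P(n ^ (-1 / 2))` is
`o_P(n ^ (-1 / 2))`. -/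
lemma tendstoInMeasure_sqrt_mul_remainder {H : ℕ → Ω → E} {r : E → ℝ} {K c δ : ℝ} (hc : 0 < c)
    (hδ : 0 < δ) (hr : ∀ h, ‖h‖ < δ → |r h| ≤ c * ‖h‖ ^ 2)
    (hH : ∀ n : ℕ, 0 < n → ∀ t > 0, P.real {ω | t ≤ ‖H n ω‖ ^ 2} ≤ K / n / t) {b : ℝ} (hb : 0 < b) :
    TendstoInMeasure P (fun (n : ℕ) ω => √n * b * r (H n ω)) atTop (fun _ => 0) := by
  rw [tendstoInMeasure_iff_measureReal_norm]
  intro ε hε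
  simp only [sub_zero, Real.norm_eq_abs]
  have h1 : Tendsto (fun n : ℕ => K / δ ^ 2 / (n : ℝ)) atTop (𝓝 0) :=
    tendsto_const_div_atTop_nhds_zero_nat _
  have h2 : Tendsto (fun n : ℕ => K * b * c / ε / √(n : ℝ)) atTop (𝓝 0) :=
    tendsto_const_nhds.div_atTop (Real.tendsto_sqrt_atTop.comp tendsto_natCast_atTop_atTop)
  have h3 := h1.add h2
  rw [add_zero] at h3
  refine tendsto_of_tendsto_of_tendsto_of_le_of_le' tendsto_const_nhds h3
    (Eventually.of_forall fun _ => measureReal_nonneg) ?_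
  filter_upwards [eventually_gt_atTop 0] with n hn
  have hn1 : (0 : ℝ) < n := by exact_mod_cast hn
  refine (measureReal_abs_remainder_ge_le (P := P) (K := K / n) hc hδ hε (by positivity) hr
    (hH n hn)).trans_eq ?_
  have h4 : (n : ℝ) = √n * √n := (Real.mul_self_sqrt hn1.le).symm
  have h5 : 0 < √(n : ℝ) := Real.sqrt_pos.2 hn1
  congr 1
  · exact div_right_comm _ _ _
  · rw [h4, Real.sqrt_mul_self h5.le]
    field_simp

end Remainder

/-- Markov's inequality for the squared norm of a random vector. -/
lemma measureReal_sq_norm_ge_le {Ω : Type*} [MeasurableSpace Ω] {P : Measure Ω}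
    [IsProbabilityMeasure P] {ι : Type*} [Fintype ι] {H : Ω → ι → ℝ}
    (hH : ∀ j, MemLp (fun ω => H ω j) 2 P) {t : ℝ} (ht : 0 < t) :
    P.real {ω | t ≤ ‖H ω‖ ^ 2} ≤ (∑ j, ∫ ω, H ω j ^ 2 ∂P) / t := by
  have hi : ∀ j, Integrable (fun ω => H ω j ^ 2) P := fun j => (hH j).integrable_sq
  have hm := mul_meas_ge_le_integral_of_nonneg (μ := P) (f := fun ω => ∑ j, H ω j ^ 2)
    (ae_of_all _ fun ω => Finset.sum_nonneg fun j _ => sq_nonneg _)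
    (integrable_finsetSum _ fun j _ => hi j) t
  rw [integral_finsetSum _ fun j _ => hi j] at hm
  rw [le_div_iff₀' ht]
  refine le_trans (mul_le_mul_of_nonneg_left (measureReal_mono fun ω hω => ?_) ht.le) hm
  refine le_trans (α := ℝ) hω ?_
  have hs : 0 ≤ ∑ j, H ω j ^ 2 := Finset.sum_nonneg fun j _ => sq_nonneg _
  -- The norm on `ι → ℝ` is the sup norm, dominated by the Euclidean one.
  have : ‖H ω‖ ≤ √(∑ j, H ω j ^ 2) := by
    refine (pi_norm_le_iff_of_nonneg (Real.sqrt_nonneg _)).2 fun j => ?_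
    rw [Real.norm_eq_abs]
    exact Real.abs_le_sqrt (Finset.single_le_sum (f := fun j => H ω j ^ 2)
      (fun j _ => sq_nonneg _) (Finset.mem_univ j))
  calc ‖H ω‖ ^ 2 ≤ √(∑ j, H ω j ^ 2) ^ 2 := by gcongr
    _ = _ := Real.sq_sqrt hs

/-- The quadratic Taylor term is absorbed into the constant. -/
lemma exists_abs_sub_fderiv_le {E : Type*} [NormedAddCommGroup E] [NormedSpace ℝ E] {g : E → ℝ}
    {a : E} (hg : ContDiffAt ℝ 2 g a) :
    ∃ c > 0, ∃ δ > 0, ∀ h, ‖h‖ < δ → |g (a + h) - g a - fderiv ℝ g a h| ≤ c * ‖h‖ ^ 2 := by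
  obtain ⟨δ, hδ, H⟩ := exists_abs_sub_taylorTwo_le hg one_pos
  refine ⟨1 + 1 / 2 * ‖fderiv ℝ (fderiv ℝ g) a‖, by positivity, δ, hδ, fun h hh => ?_⟩
  have h1 := H h hh
  have h2 := (fderiv ℝ (fderiv ℝ g) a).le_opNorm₂ h h
  rw [Real.norm_eq_abs] at h2
  have e : g (a + h) - g a - fderiv ℝ g a h =
      (g (a + h) - g a - taylorTwo g a h) + 1 / 2 * fderiv ℝ (fderiv ℝ g) a h h := by
    rw [taylorTwo]; ring
  rw [e]
  refine (abs_add_le _ _).trans ?_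
  rw [abs_mul, abs_of_pos (by norm_num : (0 : ℝ) < 1 / 2)]
  nlinarith

/-- The gradient of `steinG`. -/
noncomputable def steinGrad (a : Fin 5 → ℝ) (j : Fin 5) : ℝ :=
  ![2 * a 0 * (2 * a 4 + a 2 + steinG a * a 1), a 0 ^ 2 * steinG a, a 0 ^ 2, -steinG a,
    2 * a 0 ^ 2] j / (a 3 - a 0 ^ 2 * a 1)

/-- Coefficients of the quadratic Taylor polynomial of `steinG`. -/
noncomputable def steinQuad (a : Fin 5 → ℝ) (i j : Fin 5) : ℝ :=
  ((![![2 * a 4 + a 2 + steinG a * a 1, 2 * a 0 * steinG a, 2 * a 0, 0, 4 * a 0],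
      0, 0, 0, 0] : Fin 5 → Fin 5 → ℝ) i j
    - steinGrad a i * ![-(2 * a 0 * a 1), -a 0 ^ 2, 0, 1, 0] j) / (a 3 - a 0 ^ 2 * a 1)

lemma steinGFst_eq_sum (a h : Fin 5 → ℝ) : steinGFst a h = ∑ j, steinGrad a j * h j := by
  simp only [steinGFst, steinGrad, Fin.sum_univ_five, Matrix.cons_val]
  ring

/-- The matrix `steinQuad` is not symmetrised: only its contraction with the symmetric h_i h_j, and
later with the covariances, matters. -/
lemma steinGSnd_eq_sum (a h : Fin 5 → ℝ) :
    steinGSnd a h = ∑ i, ∑ j, steinQuad a i j * (h i * h j) := by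
  simp only [steinGSnd, steinGFst_eq_sum, steinQuad, Fin.sum_univ_five, Matrix.cons_val,
    Pi.zero_apply]
  ring

/-! ### Moments of Z and the moment equation -/

section Moments

variable {μ lam : ℝ} {f : ℝ → ℝ}

lemma memLp_steinVec (hμ : 0 < μ) (hlam : 0 < lam)
    (hmom₁ : MemLp f 2 (igMeasure μ lam))
    (hmom₂ : MemLp (fun x => x ^ 2 * f x) 2 (igMeasure μ lam))
    (hmom₃ : MemLp (fun x => x ^ 2 * deriv f x) 2 (igMeasure μ lam)) (j : Fin 5) :
    MemLp (fun x => steinVec f x j) 2 (igMeasure μ lam) := by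
  have h0 : MemLp (fun x : ℝ => x) 2 (igMeasure μ lam) :=
    (memLp_two_iff_integrable_sq measurable_id.aestronglyMeasurable).2
      (integrable_sq_igMeasure hμ hlam)
  have h2 : MemLp (fun x => x * f x) 2 (igMeasure μ lam) := by
    refine MemLp.mono' (hmom₁.norm.add hmom₂.norm)
      (measurable_id.aestronglyMeasurable.mul hmom₁.aestronglyMeasurable)
      (Eventually.of_forall fun x => ?_)
    simp only [Pi.add_apply, Real.norm_eq_abs, abs_mul, abs_pow]
    -- Uses |x| ≤ 1 + x², so xf is dominated by |f| + |x²f|.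
    nlinarith [abs_nonneg (f x), sq_nonneg (|x| - 1), sq_nonneg (|x|)]
  fin_cases j
  · exact h0
  · exact hmom₁
  · exact h2
  · exact hmom₂
  · exact hmom₃

lemma steinMean_eq (hμ : 0 < μ) [IsProbabilityMeasure (igMeasure μ lam)] :
    steinMean μ lam f = ![μ, igMoment μ lam f 0 1 0, igMoment μ lam f 1 1 0,
      igMoment μ lam f 2 1 0, igMoment μ lam f 2 0 1] := by
  ext j
  fin_cases j
  · exact integral_id_igMeasure hμ
  all_goals simp [steinMean, igMoment, steinVec]

lemma hasDerivAt_of_differentiableOn_Ioi (hf : DifferentiableOn ℝ f (Ioi 0)) {x : ℝ}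
    (hx : 0 < x) : HasDerivAt f (deriv f x) x :=
  (hf.differentiableAt (Ioi_mem_nhds hx)).hasDerivAt

/-- The moment equation behind the Stein-MM estimator. -/
lemma igMoment_stein (hμ : 0 < μ) [IsProbabilityMeasure (igMeasure μ lam)]
    (hf : DifferentiableOn ℝ f (Ioi 0))
    (hf_zero : Tendsto (fun x => f x * igPDF μ lam x) (𝓝[>] 0) (𝓝 0))
    (hZ : ∀ j, MemLp (fun x => steinVec f x j) 2 (igMeasure μ lam)) :
    2 * igMoment μ lam f 2 0 1 + igMoment μ lam f 1 1 0 = lam * igTheta μ lam f / μ ^ 2 := by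
  have i1 : Integrable (fun x => f x) (igMeasure μ lam) := (hZ 1).integrable (by norm_num)
  have i2 : Integrable (fun x => x * f x) (igMeasure μ lam) := (hZ 2).integrable (by norm_num)
  have i3 : Integrable (fun x => x ^ 2 * f x) (igMeasure μ lam) := (hZ 3).integrable (by norm_num)
  have i4 : Integrable (fun x => x ^ 2 * deriv f x) (igMeasure μ lam) :=
    (hZ 4).integrable (by norm_num)
  have e : (fun x => 2 * x ^ 2 * deriv f x + x * f x - lam / μ ^ 2 * (x ^ 2 - μ ^ 2) * f x) =
      fun x => 2 * (x ^ 2 * deriv f x) + x * f x - lam / μ ^ 2 * (x ^ 2 * f x - μ ^ 2 * f x) := by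
    ext x; ring
  have j1 : Integrable (fun x => 2 * (x ^ 2 * deriv f x) + x * f x) (igMeasure μ lam) :=
    (i4.const_mul 2).add i2
  have j2 : Integrable (fun x => lam / μ ^ 2 * (x ^ 2 * f x - μ ^ 2 * f x)) (igMeasure μ lam) :=
    (i3.sub (i1.const_mul _)).const_mul _
  have key := igMeasure_stein (lam := lam) hμ (fun x hx => hasDerivAt_of_differentiableOn_Ioi hf hx)
    (by
      have : Tendsto (fun x : ℝ => x ^ 2) (𝓝[>] 0) (𝓝 0) := by
        simpa using ((continuous_pow 2).tendsto (0 : ℝ)).mono_left nhdsWithin_le_nhds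
      simpa [mul_assoc] using this.mul hf_zero)
    i3 (by rw [e]; exact j1.sub j2)
  rw [e, integral_sub j1 j2, integral_add (i4.const_mul 2) i2, integral_const_mul,
    integral_const_mul, integral_sub i3 (i1.const_mul _), integral_const_mul] at key
  simp only [igTheta, igMoment, pow_zero, pow_one, mul_one, one_mul]
  rw [sub_eq_zero] at key
  rw [key]
  ring

/-- The estimator is the moment equation solved for λ, with sample means replacing expectations. -/
lemma steinG_steinMean (hμ : 0 < μ) (hlam : 0 < lam) [IsProbabilityMeasure (igMeasure μ lam)]
    (hf : DifferentiableOn ℝ f (Ioi 0))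
    (hf_zero : Tendsto (fun x => f x * igPDF μ lam x) (𝓝[>] 0) (𝓝 0))
    (hZ : ∀ j, MemLp (fun x => steinVec f x j) 2 (igMeasure μ lam)) (hθ : igTheta μ lam f ≠ 0) :
    steinG (steinMean μ lam f) = lam := by
  rw [steinMean_eq hμ]
  simp only [steinG, Matrix.cons_val]
  rw [igMoment_stein hμ hf hf_zero hZ, ← igTheta]
  field_simp

/-- The covariance matrix of the five statistics. -/
noncomputable def steinCov (μ lam : ℝ) (f : ℝ → ℝ) (i j : Fin 5) : ℝ :=
  ∫ x, (steinVec f x i - steinMean μ lam f i) * (steinVec f x j - steinMean μ lam f j)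
    ∂(igMeasure μ lam)

lemma memLp_steinVec_sub [IsProbabilityMeasure (igMeasure μ lam)]
    (hZ : ∀ j, MemLp (fun x => steinVec f x j) 2 (igMeasure μ lam)) (j : Fin 5) :
    MemLp (fun x => steinVec f x j - steinMean μ lam f j) 2 (igMeasure μ lam) :=
  (hZ j).sub (memLp_const _)

lemma integral_steinVec_sub [IsProbabilityMeasure (igMeasure μ lam)]
    (hZ : ∀ j, MemLp (fun x => steinVec f x j) 2 (igMeasure μ lam)) (j : Fin 5) :
    ∫ x, (steinVec f x j - steinMean μ lam f j) ∂(igMeasure μ lam) = 0 := by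
  rw [integral_sub ((hZ j).integrable (by norm_num)) (integrable_const _)]
  simp [steinMean]

lemma steinCov_eq_sub [IsProbabilityMeasure (igMeasure μ lam)]
    (hZ : ∀ j, MemLp (fun x => steinVec f x j) 2 (igMeasure μ lam)) (i j : Fin 5) :
    steinCov μ lam f i j = ∫ x, steinVec f x i * steinVec f x j ∂(igMeasure μ lam)
      - steinMean μ lam f i * steinMean μ lam f j := by
  have hi : Integrable (fun x => steinVec f x i * steinVec f x j) (igMeasure μ lam) :=
    (hZ i).integrable_mul (hZ j)
  have hj := ((hZ j).integrable (by norm_num)).const_mul (steinMean μ lam f i)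
  have e : (fun x => (steinVec f x i - steinMean μ lam f i) *
      (steinVec f x j - steinMean μ lam f j)) = fun x =>
        (steinVec f x i * steinVec f x j - steinMean μ lam f i * steinVec f x j)
        - steinMean μ lam f j * (steinVec f x i - steinMean μ lam f i) := by
    ext x; ring
  have hij : Integrable (fun x => steinVec f x i * steinVec f x j
      - steinMean μ lam f i * steinVec f x j) (igMeasure μ lam) := hi.sub hj
  rw [steinCov, e, integral_sub hij
    (((memLp_steinVec_sub hZ i).integrable (by norm_num)).const_mul _), integral_const_mul,
    integral_steinVec_sub hZ, integral_sub hi hj, integral_const_mul]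
  simp [steinMean]

/-- The matrix of second moments of the five statistics. -/
lemma integral_steinVec_mul (hμ : 0 < μ) (hlam : 0 < lam)
    [IsProbabilityMeasure (igMeasure μ lam)] (i j : Fin 5) :
    ∫ x, steinVec f x i * steinVec f x j ∂(igMeasure μ lam) =
      (let M := igMoment μ lam f
      !![μ ^ 2 + μ ^ 3 / lam, M 1 1 0, M 2 1 0, M 3 1 0, M 3 0 1;
        M 1 1 0, M 0 2 0, M 1 2 0, M 2 2 0, M 2 1 1;
        M 2 1 0, M 1 2 0, M 2 2 0, M 3 2 0, M 3 1 1;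
        M 3 1 0, M 2 2 0, M 3 2 0, M 4 2 0, M 4 1 1;
        M 3 0 1, M 2 1 1, M 3 1 1, M 4 1 1, M 4 0 2] i j) := by
  rw [← integral_sq_igMeasure hμ hlam]
  fin_cases i <;> fin_cases j <;>
    simp only [steinVec, igMoment, Fin.zero_eta, Fin.mk_one, Fin.reduceFinMk, Matrix.cons_val,
      Matrix.of_apply] <;>
    exact integral_congr_ae (Eventually.of_forall fun x => by ring)

end Moments

/-! ### Closed forms for variance and bias; positivity of the variance -/

section AsymptoticMoments

variable {μ lam : ℝ} {f : ℝ → ℝ}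

/-- The linear statistic governing the asymptotic distribution of the estimator. -/
noncomputable def steinScore (μ lam : ℝ) (f : ℝ → ℝ) (x : ℝ) : ℝ :=
  steinGFst (steinMean μ lam f) (fun j => steinVec f x j - steinMean μ lam f j)

lemma steinScore_eq_sum (x : ℝ) : steinScore μ lam f x =
    ∑ j, steinGrad (steinMean μ lam f) j * (steinVec f x j - steinMean μ lam f j) := by
  rw [steinScore, steinGFst_eq_sum]

lemma memLp_steinScore [IsProbabilityMeasure (igMeasure μ lam)]
    (hZ : ∀ j, MemLp (fun x => steinVec f x j) 2 (igMeasure μ lam)) :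
    MemLp (steinScore μ lam f) 2 (igMeasure μ lam) := by
  rw [funext steinScore_eq_sum]
  exact memLp_finsetSum _ fun j _ => (memLp_steinVec_sub hZ j).const_mul _

lemma integral_steinScore [IsProbabilityMeasure (igMeasure μ lam)]
    (hZ : ∀ j, MemLp (fun x => steinVec f x j) 2 (igMeasure μ lam)) :
    ∫ x, steinScore μ lam f x ∂(igMeasure μ lam) = 0 := by
  simp only [steinScore_eq_sum]
  rw [integral_finsetSum _ fun j _ =>
    ((memLp_steinVec_sub hZ j).integrable (by norm_num)).const_mul _]
  simp [integral_const_mul, integral_steinVec_sub hZ]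

lemma integral_steinScore_sq [IsProbabilityMeasure (igMeasure μ lam)]
    (hZ : ∀ j, MemLp (fun x => steinVec f x j) 2 (igMeasure μ lam)) :
    ∫ x, steinScore μ lam f x ^ 2 ∂(igMeasure μ lam) = ∑ i, ∑ j,
      steinGrad (steinMean μ lam f) i * steinGrad (steinMean μ lam f) j * steinCov μ lam f i j := by
  have e : ∀ x, steinScore μ lam f x ^ 2 = ∑ i, ∑ j,
      steinGrad (steinMean μ lam f) i * steinGrad (steinMean μ lam f) j *
        ((steinVec f x i - steinMean μ lam f i) * (steinVec f x j - steinMean μ lam f j)) := by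
    intro x
    rw [steinScore_eq_sum, sq, Finset.sum_mul_sum]
    exact Finset.sum_congr rfl fun i _ => Finset.sum_congr rfl fun j _ => by ring
  have hi : ∀ i j, Integrable (fun x => steinGrad (steinMean μ lam f) i *
      steinGrad (steinMean μ lam f) j * ((steinVec f x i - steinMean μ lam f i) *
        (steinVec f x j - steinMean μ lam f j))) (igMeasure μ lam) := fun i j =>
    ((memLp_steinVec_sub hZ i).integrable_mul (memLp_steinVec_sub hZ j)).const_mul _
  simp only [e]
  rw [integral_finsetSum _ fun i _ => integrable_finsetSum _ fun j _ => hi i j]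
  refine Finset.sum_congr rfl fun i _ => ?_
  rw [integral_finsetSum _ fun j _ => hi i j]
  exact Finset.sum_congr rfl fun j _ => by rw [integral_const_mul, steinCov]

/-- Eliminating this moment leaves θ as a free variable, so the closed forms become rational
identities with denominators that are monomials in nonzero quantities. -/
lemma igMoment_zero_one_zero_eq (hμ : 0 < μ) :
    igMoment μ lam f 0 1 0 = (igMoment μ lam f 2 1 0 - igTheta μ lam f) / μ ^ 2 := by
  rw [igTheta]
  field_simp
  ring

/-- The right side is the delta-method variance ∇gᵀΣ∇g/n. The closed form agrees with it only modulo
the moment equation, used to eliminate μ_f(2,0,1), and the definition of ϑ_f. -/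
lemma igAsympVar_eq_sum (hμ : 0 < μ) (hlam : 0 < lam) [IsProbabilityMeasure (igMeasure μ lam)]
    (hf : DifferentiableOn ℝ f (Ioi 0))
    (hf_zero : Tendsto (fun x => f x * igPDF μ lam x) (𝓝[>] 0) (𝓝 0))
    (hZ : ∀ j, MemLp (fun x => steinVec f x j) 2 (igMeasure μ lam)) (hθ : igTheta μ lam f ≠ 0)
    (n : ℕ) :
    igAsympVar μ lam f n = (1 / (n : ℝ)) * ∑ i, ∑ j,
      steinGrad (steinMean μ lam f) i * steinGrad (steinMean μ lam f) j * steinCov μ lam f i j := by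
  have hG := steinG_steinMean hμ hlam hf hf_zero hZ hθ
  have hS := igMoment_stein hμ hf hf_zero hZ
  have h201 : igMoment μ lam f 2 0 1 =
      (lam * igTheta μ lam f / μ ^ 2 - igMoment μ lam f 1 1 0) / 2 := by linarith
  rw [igAsympVar]
  congr 1
  simp only [steinCov_eq_sub hZ, integral_steinVec_mul hμ hlam, steinGrad, hG]
  simp only [steinMean_eq hμ, Fin.sum_univ_five, Matrix.cons_val, Matrix.of_apply]
  rw [h201, igMoment_zero_one_zero_eq hμ]
  generalize igTheta μ lam f = θ at hθ ⊢
  generalize igMoment μ lam f = M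
  rw [show M 2 1 0 - μ ^ 2 * ((M 2 1 0 - θ) / μ ^ 2) = θ by field_simp; ring]
  field_simp
  ring

/-- The right side contracts the quadratic Taylor coefficients with Σ/n; the same eliminations as
for the variance apply. -/
lemma igAsympBias_eq_sum (hμ : 0 < μ) (hlam : 0 < lam) [IsProbabilityMeasure (igMeasure μ lam)]
    (hf : DifferentiableOn ℝ f (Ioi 0))
    (hf_zero : Tendsto (fun x => f x * igPDF μ lam x) (𝓝[>] 0) (𝓝 0))
    (hZ : ∀ j, MemLp (fun x => steinVec f x j) 2 (igMeasure μ lam)) (hθ : igTheta μ lam f ≠ 0)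
    (n : ℕ) :
    igAsympBias μ lam f n = (1 / (n : ℝ)) * ∑ i, ∑ j,
      steinQuad (steinMean μ lam f) i j * steinCov μ lam f i j := by
  have hG := steinG_steinMean hμ hlam hf hf_zero hZ hθ
  have hS := igMoment_stein hμ hf hf_zero hZ
  have h201 : igMoment μ lam f 2 0 1 =
      (lam * igTheta μ lam f / μ ^ 2 - igMoment μ lam f 1 1 0) / 2 := by linarith
  rw [igAsympBias]
  congr 1
  simp only [steinCov_eq_sub hZ, integral_steinVec_mul hμ hlam, steinQuad, steinGrad, hG]
  simp only [steinMean_eq hμ, Fin.sum_univ_five, Matrix.cons_val, Matrix.of_apply, Pi.zero_apply]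
  rw [h201, igMoment_zero_one_zero_eq hμ]
  generalize igTheta μ lam f = θ at hθ ⊢
  generalize igMoment μ lam f = M
  rw [show M 2 1 0 - μ ^ 2 * ((M 2 1 0 - θ) / μ ^ 2) = θ by field_simp; ring]
  field_simp
  ring

/-- The score is not almost surely zero. -/
lemma not_ae_steinScore_eq_zero (hμ : 0 < μ) (hlam : 0 < lam)
    [IsProbabilityMeasure (igMeasure μ lam)] (hf : DifferentiableOn ℝ f (Ioi 0))
    (hf_zero : Tendsto (fun x => f x * igPDF μ lam x) (𝓝[>] 0) (𝓝 0))
    (hZ : ∀ j, MemLp (fun x => steinVec f x j) 2 (igMeasure μ lam)) (hθ : igTheta μ lam f ≠ 0) :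
    ¬ steinScore μ lam f =ᵐ[igMeasure μ lam] 0 := by
  intro h0
  have hG := steinG_steinMean hμ hlam hf hf_zero hZ hθ
  have hS := igMoment_stein hμ hf hf_zero hZ
  have h201 : igMoment μ lam f 2 0 1 =
      (lam * igTheta μ lam f / μ ^ 2 - igMoment μ lam f 1 1 0) / 2 := by linarith
  obtain ⟨u, hu⟩ : ∃ u, u = 2 * lam * igMoment μ lam f 2 1 0 / μ := ⟨_, rfl⟩
  -- Up to the factor μ² this is Af = −(u/μ²)(x − μ), with A the Stein operator: a vanishing score
  -- is a differential equation for `f`.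
  have hode : ∀ᵐ x ∂(igMeasure μ lam), lam * μ ^ 2 * f x + μ ^ 2 * (x * f x)
      - lam * (x ^ 2 * f x) + 2 * μ ^ 2 * (x ^ 2 * deriv f x) = -(u * (x - μ)) := by
    filter_upwards [h0] with x hx
    rw [steinScore_eq_sum] at hx
    simp only [steinGrad, hG] at hx
    simp only [steinMean_eq hμ, steinVec, Fin.sum_univ_five, Matrix.cons_val, Pi.zero_apply] at hx
    rw [h201, igMoment_zero_one_zero_eq hμ] at hx
    generalize igTheta μ lam f = θ at hθ hx
    generalize igMoment μ lam f = M at *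
    rw [show M 2 1 0 - μ ^ 2 * ((M 2 1 0 - θ) / μ ^ 2) = θ by field_simp; ring] at hx
    rw [hu]
    field_simp at hx ⊢
    linarith
  have i1 : Integrable (fun x => f x) (igMeasure μ lam) := (hZ 1).integrable (by norm_num)
  have i3 : Integrable (fun x => x ^ 2 * f x) (igMeasure μ lam) := (hZ 3).integrable (by norm_num)
  have k1 : Integrable (fun x : ℝ => x) (igMeasure μ lam) := integrable_id_igMeasure hμ hlam
  have k2 : Integrable (fun x : ℝ => x ^ 2) (igMeasure μ lam) := integrable_sq_igMeasure hμ hlam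
  have k3 : Integrable (fun x : ℝ => x⁻¹) (igMeasure μ lam) := integrable_inv_igMeasure hμ hlam
  -- The third-order moment exists as a product of two square-integrable factors.
  have l1 : Integrable (fun x => x * (x ^ 2 * f x)) (igMeasure μ lam) :=
    (hZ 0).integrable_mul (hZ 3)
  have l2 : Integrable (fun x => x * f x) (igMeasure μ lam) := (hZ 2).integrable (by norm_num)
  have m1 : Integrable (fun x : ℝ => x ^ 2 + μ ^ 2) (igMeasure μ lam) :=
    k2.add (integrable_const _)
  have m2 : Integrable (fun x : ℝ => μ * x + μ ^ 3 * x⁻¹) (igMeasure μ lam) :=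
    (k1.const_mul _).add (k3.const_mul _)
  have m3 : Integrable (fun x : ℝ => u / μ ^ 2 * ((x ^ 2 + μ ^ 2) - (μ * x + μ ^ 3 * x⁻¹)))
    (igMeasure μ lam) := (m1.sub m2).const_mul _
  have m4 : Integrable (fun x : ℝ => 2 * (x ^ 2 * f x - μ ^ 2 * f x)) (igMeasure μ lam) :=
    (i3.sub (i1.const_mul _)).const_mul _
  have e : (fun x => 2 * x ^ 2 * (deriv f x * (x + μ ^ 2 * x⁻¹)
        + f x * (1 + μ ^ 2 * -(x ^ 2)⁻¹)) + x * (f x * (x + μ ^ 2 * x⁻¹))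
        - lam / μ ^ 2 * (x ^ 2 - μ ^ 2) * (f x * (x + μ ^ 2 * x⁻¹))) =ᵐ[igMeasure μ lam]
      fun x => 2 * (x ^ 2 * f x - μ ^ 2 * f x)
        - u / μ ^ 2 * ((x ^ 2 + μ ^ 2) - (μ * x + μ ^ 3 * x⁻¹)) := by
    filter_upwards [hode, ae_pos_igMeasure hlam] with x hx hx0
    have : f x * lam * μ ^ 2 = -(μ ^ 2 * (x * f x))
      + lam * (x ^ 2 * f x) - 2 * μ ^ 2 * (x ^ 2 * deriv f x) - (u * (x - μ)) := by linarith
    field_simp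
    linear_combination (x ^ 2 + μ ^ 2) * this
  -- The multiplier p = x + μ²/x has 2x²p' = 2(x² − μ²), which produces 2ϑ_f, while p(X) is
  -- uncorrelated with X − μ, which removes the right side of the differential equation.
  have key := igMeasure_stein (lam := lam) hμ (w := fun x => f x * (x + μ ^ 2 * x⁻¹))
    (w' := fun x => deriv f x * (x + μ ^ 2 * x⁻¹) + f x * (1 + μ ^ 2 * -(x ^ 2)⁻¹))
    (fun x hx => (hasDerivAt_of_differentiableOn_Ioi hf hx).mul
      ((hasDerivAt_id x).add ((hasDerivAt_inv hx.ne').const_mul _)))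
    (by
      have hc : Continuous fun x : ℝ => x ^ 3 + μ ^ 2 * x := by fun_prop
      have : Tendsto (fun x : ℝ => x ^ 3 + μ ^ 2 * x) (𝓝[>] 0) (𝓝 0) := by
        simpa using (hc.tendsto (0 : ℝ)).mono_left nhdsWithin_le_nhds
      have h := this.mul hf_zero
      rw [mul_zero] at h
      refine h.congr' ?_
      filter_upwards [self_mem_nhdsWithin] with x (hx : 0 < x)
      field_simp)
    ((l1.add (l2.const_mul (μ ^ 2))).congr (by
      filter_upwards [ae_pos_igMeasure hlam] with x hx
      simp only [Pi.add_apply]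
      field_simp))
    ((m4.sub m3).congr e.symm)
  rw [integral_congr_ae e, integral_sub m4 m3, integral_const_mul, integral_const_mul,
    integral_sub i3 (i1.const_mul _), integral_sub m1 m2,
    integral_add k2 (integrable_const _), integral_add (k1.const_mul _) (k3.const_mul _),
    integral_const_mul, integral_const_mul, integral_const_mul, integral_sq_igMeasure hμ hlam,
    integral_id_igMeasure hμ, integral_inv_igMeasure hμ hlam] at key
  simp only [integral_const, probReal_univ, smul_eq_mul, one_mul] at key
  have e1 : ∫ x, x ^ 2 * f x ∂(igMeasure μ lam) - μ ^ 2 * ∫ x, f x ∂(igMeasure μ lam)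
      = igTheta μ lam f := by
    simp [igTheta, igMoment]
  rw [e1, show μ ^ 2 + μ ^ 3 / lam + μ ^ 2 - (μ * μ + μ ^ 3 * (1 / μ + 1 / lam)) = 0 by
    field_simp; ring] at key
  apply hθ
  linarith

lemma integral_steinScore_sq_pos (hμ : 0 < μ) (hlam : 0 < lam)
    [IsProbabilityMeasure (igMeasure μ lam)] (hf : DifferentiableOn ℝ f (Ioi 0))
    (hf_zero : Tendsto (fun x => f x * igPDF μ lam x) (𝓝[>] 0) (𝓝 0))
    (hZ : ∀ j, MemLp (fun x => steinVec f x j) 2 (igMeasure μ lam)) (hθ : igTheta μ lam f ≠ 0) :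
    0 < ∫ x, steinScore μ lam f x ^ 2 ∂(igMeasure μ lam) := by
  refine lt_of_le_of_ne (integral_nonneg fun x => sq_nonneg _) fun h => ?_
  have := (integral_eq_zero_iff_of_nonneg (fun x => sq_nonneg (steinScore μ lam f x))
    (memLp_steinScore hZ).integrable_sq).1 h.symm
  refine not_ae_steinScore_eq_zero hμ hlam hf hf_zero hZ hθ ?_
  filter_upwards [this] with x hx
  simpa using hx

end AsymptoticMoments

/-! ### The estimation error and the limit theorems -/

lemma steinMM_eq_steinG {Ω : Type*} (f : ℝ → ℝ) (X : ℕ → Ω → ℝ) (n : ℕ) (ω : Ω) :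
    steinMM f X n ω = steinG (steinSampleMean f X n ω) := by
  simp [steinMM, steinG, steinSampleMean, steinVec]

/-- The centred vector of sample means. -/
noncomputable def steinError {Ω : Type*} (μ lam : ℝ) (f : ℝ → ℝ) (X : ℕ → Ω → ℝ) (n : ℕ) (ω : Ω) :
    Fin 5 → ℝ :=
  steinSampleMean f X n ω - steinMean μ lam f

lemma steinError_apply {Ω : Type*} {μ lam : ℝ} {f : ℝ → ℝ} {X : ℕ → Ω → ℝ} {n : ℕ} (hn : 0 < n) (ω : Ω)
    (j : Fin 5) :
    steinError μ lam f X n ω j =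
      sampleMean X (fun x => steinVec f x j - steinMean μ lam f j) n ω := by
  have : (n : ℝ) ≠ 0 := by positivity
  simp only [steinError, steinSampleMean, sampleMean, Pi.sub_apply, Finset.sum_sub_distrib,
    Finset.sum_const, Finset.card_range, nsmul_eq_mul]
  field_simp

section Estimator

variable {Ω : Type*} [MeasurableSpace Ω] {P : Measure Ω} {μ lam : ℝ} {f : ℝ → ℝ}
  {X : ℕ → Ω → ℝ}

lemma aemeasurable_steinMM (hlaw : ∀ i, HasLaw (X i) (igMeasure μ lam) P)
    (hZ : ∀ j, MemLp (fun x => steinVec f x j) 2 (igMeasure μ lam)) (n : ℕ) :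
    AEMeasurable (steinMM f X n) P := by
  have h := fun j => aemeasurable_sampleMean hlaw (hZ j).aestronglyMeasurable.aemeasurable n
  exact (((h 0).pow_const 2).mul (((h 4).const_mul 2).add (h 2))).div
    ((h 3).sub (((h 0).pow_const 2).mul (h 1)))

lemma memLp_steinError [IsProbabilityMeasure (igMeasure μ lam)]
    (hlaw : ∀ i, HasLaw (X i) (igMeasure μ lam) P)
    (hZ : ∀ j, MemLp (fun x => steinVec f x j) 2 (igMeasure μ lam)) {n : ℕ} (hn : 0 < n)
    (j : Fin 5) : MemLp (fun ω => steinError μ lam f X n ω j) 2 P := by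
  simp only [steinError_apply hn]
  exact memLp_sampleMean hlaw (memLp_steinVec_sub hZ j) n

variable [IsProbabilityMeasure P] [IsProbabilityMeasure (igMeasure μ lam)]

lemma integral_steinError (hlaw : ∀ i, HasLaw (X i) (igMeasure μ lam) P)
    (hZ : ∀ j, MemLp (fun x => steinVec f x j) 2 (igMeasure μ lam)) {n : ℕ} (hn : 0 < n)
    (j : Fin 5) : ∫ ω, steinError μ lam f X n ω j ∂P = 0 := by
  simp only [steinError_apply hn]
  rw [integral_sampleMean hlaw (memLp_steinVec_sub hZ j) hn, integral_steinVec_sub hZ]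

lemma integral_steinError_mul (hlaw : ∀ i, HasLaw (X i) (igMeasure μ lam) P)
    (hindep : iIndepFun X P)
    (hZ : ∀ j, MemLp (fun x => steinVec f x j) 2 (igMeasure μ lam)) {n : ℕ} (hn : 0 < n)
    (i j : Fin 5) : ∫ ω, steinError μ lam f X n ω i * steinError μ lam f X n ω j ∂P =
      steinCov μ lam f i j / n := by
  simp only [steinError_apply hn]
  exact integral_sampleMean_mul hlaw hindep (memLp_steinVec_sub hZ i) (memLp_steinVec_sub hZ j)
    (integral_steinVec_sub hZ i) hn

lemma measureReal_steinError_ge_le (hlaw : ∀ i, HasLaw (X i) (igMeasure μ lam) P)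
    (hindep : iIndepFun X P)
    (hZ : ∀ j, MemLp (fun x => steinVec f x j) 2 (igMeasure μ lam)) (n : ℕ) (hn : 0 < n)
    (t : ℝ) (ht : t > 0) :
    P.real {ω | t ≤ ‖steinError μ lam f X n ω‖ ^ 2} ≤ (∑ j, steinCov μ lam f j j) / n / t := by
  refine (measureReal_sq_norm_ge_le (memLp_steinError hlaw hZ hn) ht).trans_eq ?_
  simp only [sq, integral_steinError_mul hlaw hindep hZ hn, Finset.sum_div]

/-- The Taylor approximation is integrable, with mean given by the covariance matrix. -/
lemma integral_taylorTwo_steinError (hlaw : ∀ i, HasLaw (X i) (igMeasure μ lam) P)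
    (hindep : iIndepFun X P)
    (hZ : ∀ j, MemLp (fun x => steinVec f x j) 2 (igMeasure μ lam))
    (hD : steinMean μ lam f 3 - steinMean μ lam f 0 ^ 2 * steinMean μ lam f 1 ≠ 0)
    {n : ℕ} (hn : 0 < n) :
    Integrable (steinTaylor μ lam f X n) P ∧
      ∫ ω, steinTaylor μ lam f X n ω ∂P = (1 / (n : ℝ)) * ∑ i, ∑ j,
        steinQuad (steinMean μ lam f) i j * steinCov μ lam f i j := by
  have e : steinTaylor μ lam f X n = fun ω =>
      ∑ j, steinGrad (steinMean μ lam f) j * steinError μ lam f X n ω j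
      + ∑ i, ∑ j, steinQuad (steinMean μ lam f) i j *
        (steinError μ lam f X n ω i * steinError μ lam f X n ω j) := by
    ext ω
    rw [← steinGFst_eq_sum, ← steinGSnd_eq_sum, ← taylorTwo_steinG hD]
    rfl
  have i1 : ∀ j, Integrable (fun ω => steinGrad (steinMean μ lam f) j *
      steinError μ lam f X n ω j) P := fun j =>
    ((memLp_steinError hlaw hZ hn j).integrable (by norm_num)).const_mul _
  have i2 : ∀ i j, Integrable (fun ω => steinQuad (steinMean μ lam f) i j *
      (steinError μ lam f X n ω i * steinError μ lam f X n ω j)) P := fun i j =>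
    ((memLp_steinError hlaw hZ hn i).integrable_mul (memLp_steinError hlaw hZ hn j)).const_mul _
  have j1 := integrable_finsetSum Finset.univ fun j _ => i1 j
  have j2 := integrable_finsetSum Finset.univ fun i _ =>
    integrable_finsetSum Finset.univ fun j _ => i2 i j
  rw [e]
  refine ⟨j1.add j2, ?_⟩
  rw [integral_add j1 j2, integral_finsetSum _ fun j _ => i1 j,
    integral_finsetSum _ fun i _ => integrable_finsetSum Finset.univ fun j _ => i2 i j]
  simp only [integral_finsetSum _ fun j _ => i2 _ j, integral_const_mul,
    integral_steinError hlaw hZ hn, integral_steinError_mul hlaw hindep hZ hn, mul_zero,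
    Finset.sum_const_zero, zero_add, Finset.mul_sum]
  exact Finset.sum_congr rfl fun i _ => Finset.sum_congr rfl fun j _ => by ring

/-- Central limit theorem for the linear part of the estimation error. -/
lemma tendstoInDistribution_steinScore (hlaw : ∀ i, HasLaw (X i) (igMeasure μ lam) P)
    (hindep : iIndepFun X P)
    (hZ : ∀ j, MemLp (fun x => steinVec f x j) 2 (igMeasure μ lam)) {V : ℝ} (hV : 0 < V)
    (hVeq : ∫ x, steinScore μ lam f x ^ 2 ∂(igMeasure μ lam) = V) :
    TendstoInDistribution (fun (n : ℕ) ω => (√n)⁻¹ * ∑ k ∈ Finset.range n,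
      steinScore μ lam f (X k ω) / √V) atTop (id : ℝ → ℝ) (fun _ => P) (gaussianReal 0 1) := by
  have hs := memLp_steinScore hZ
  have hm : AEMeasurable (fun x => steinScore μ lam f x / √V) (igMeasure μ lam) :=
    hs.aestronglyMeasurable.aemeasurable.div_const _
  have hm' : ∀ i, AEMeasurable (fun x => steinScore μ lam f x / √V) (P.map (X i)) := fun i =>
    (hlaw i).map_eq ▸ hm
  refine tendstoInDistribution_inv_sqrt_mul_sum HasLaw.id ?_ ?_
    (hindep.comp₀ (fun _ x => steinScore μ lam f x / √V) (fun i => (hlaw i).aemeasurable) hm') ?_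
  · refine ((hlaw 0).integral_comp hm.aestronglyMeasurable).trans ?_
    rw [integral_div, integral_steinScore hZ, zero_div]
  · refine ((hlaw 0).integral_comp (f := fun x => (steinScore μ lam f x / √V) ^ 2)
      (hm.pow_const 2).aestronglyMeasurable).trans ?_
    simp only [div_pow, Real.sq_sqrt hV.le]
    rw [integral_div, hVeq, div_self hV.ne']
  · intro i
    have hid : IdentDistrib (X i) (X 0) P P :=
      ⟨(hlaw i).aemeasurable, (hlaw 0).aemeasurable, (hlaw i).map_eq.trans (hlaw 0).map_eq.symm⟩
    exact hid.comp_of_aemeasurable (hm' i)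

end Estimator

theorem mainTheorem1 {Ω : Type*} [MeasurableSpace Ω] (P : Measure Ω) [IsProbabilityMeasure P]
    (μ lam : ℝ) (hμ : 0 < μ) (hlam : 0 < lam)
    (f : ℝ → ℝ) (hf : DifferentiableOn ℝ f (Ioi 0))
    (hf_zero : Tendsto (fun x => f x * igPDF μ lam x) (𝓝[>] 0) (𝓝 0))
    (hf_top : Tendsto (fun x => f x * igPDF μ lam x) atTop (𝓝 0))
    (hmom₁ : MemLp f 2 (igMeasure μ lam))
    (hmom₂ : MemLp (fun x => x ^ 2 * f x) 2 (igMeasure μ lam))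
    (hmom₃ : MemLp (fun x => x ^ 2 * deriv f x) 2 (igMeasure μ lam))
    (hθ : igTheta μ lam f ≠ 0)
    (X : ℕ → Ω → ℝ) (hlaw : ∀ i, HasLaw (X i) (igMeasure μ lam) P) (hindep : iIndepFun X P) :
    -- asymptotic normality: `steinMM f X n` is AN(`lam`, `igAsympVar μ lam f n`)
    (∀ n, 0 < n → 0 < igAsympVar μ lam f n) ∧
    TendstoInDistribution
      (fun (n : ℕ) ω => (steinMM f X n ω - lam) / Real.sqrt (igAsympVar μ lam f n))
      atTop (id : ℝ → ℝ) (fun _ => P) (gaussianReal 0 1) ∧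
    -- asymptotic bias: the second-order Taylor approximation of the estimation error is
    -- accurate up to `o_P(1/n)`, and its mean is `igAsympBias μ lam f n`
    TendstoInMeasure P
      (fun (n : ℕ) ω => (n : ℝ) * (steinMM f X n ω - lam - steinTaylor μ lam f X n ω))
      atTop (fun _ => 0) ∧
    (∀ n, 0 < n → Integrable (steinTaylor μ lam f X n) P ∧
      ∫ ω, steinTaylor μ lam f X n ω ∂P = igAsympBias μ lam f n) := by
  -- The normalising constant need not be computed: the measure is the law of `X 0`.
  have : IsProbabilityMeasure (igMeasure μ lam) := (hlaw 0).isProbabilityMeasure_iff.1 ‹_›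
  have hZ := memLp_steinVec hμ hlam hmom₁ hmom₂ hmom₃
  have hG := steinG_steinMean hμ hlam hf hf_zero hZ hθ
  have hD : steinMean μ lam f 3 - steinMean μ lam f 0 ^ 2 * steinMean μ lam f 1 ≠ 0 := by
    rw [steinMean_eq hμ]
    exact hθ
  obtain ⟨V, hVeq⟩ : ∃ V, ∫ x, steinScore μ lam f x ^ 2 ∂(igMeasure μ lam) = V := ⟨_, rfl⟩
  have hV : 0 < V := hVeq ▸ integral_steinScore_sq_pos hμ hlam hf hf_zero hZ hθ
  have hvar : ∀ n, igAsympVar μ lam f n = V / n := fun n => by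
    rw [igAsympVar_eq_sum hμ hlam hf hf_zero hZ hθ, ← integral_steinScore_sq hZ, hVeq]
    ring
  have hsM : ∀ n ω, steinMM f X n ω =
      steinG (steinMean μ lam f + steinError μ lam f X n ω) := fun n ω => by
    rw [steinMM_eq_steinG, steinError, add_sub_cancel]
  have htail := measureReal_steinError_ge_le hlaw hindep hZ
  refine ⟨fun n hn => ?_, ?_, ?_, fun n hn => ?_⟩
  · rw [hvar]
    positivity
  · obtain ⟨c, hc, δ, hδ, hr⟩ := exists_abs_sub_fderiv_le (contDiffAt_steinG hD)
    -- Slutsky: the standardised error differs from the normalised sum of scores by √(n/V) times the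
    -- first-order Taylor remainder.
    refine tendstoInDistribution_of_tendstoInMeasure_sub _ _
      (tendstoInDistribution_steinScore hlaw hindep hZ hV hVeq) ?_
      fun n => ((aemeasurable_steinMM hlaw hZ n).sub_const _).div_const _
    have hrem := tendstoInMeasure_sqrt_mul_remainder hc hδ hr htail
      (inv_pos.2 (Real.sqrt_pos.2 hV))
    refine hrem.congr_left fun n => Eventually.of_forall fun ω => ?_
    simp only [Pi.sub_apply]
    rcases Nat.eq_zero_or_pos n with rfl | hn
    -- At n = 0 both sides are 0, by the convention for division by zero.
    · simp [hvar]
    have hn' : (0 : ℝ) < n := by exact_mod_cast hn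
    have hlin : steinGFst (steinMean μ lam f) (steinError μ lam f X n ω) =
        (1 / (n : ℝ)) * ∑ k ∈ Finset.range n, steinScore μ lam f (X k ω) := by
      simp only [steinGFst_eq_sum, steinError_apply hn, sampleMean, steinScore_eq_sum]
      rw [Finset.sum_comm, Finset.mul_sum]
      refine Finset.sum_congr rfl fun j _ => ?_
      rw [← Finset.mul_sum]
      ring
    rw [(steinG_line hD _).1, hlin, hG, ← hsM, hvar, Real.sqrt_div hV.le, ← Finset.sum_div]
    have h1 : 0 < √V := Real.sqrt_pos.2 hV
    have h2 : 0 < √(n : ℝ) := Real.sqrt_pos.2 hn'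
    have h3 : (1 / (n : ℝ)) = (√n)⁻¹ * (√n)⁻¹ := by
      rw [← mul_inv, Real.mul_self_sqrt hn'.le, one_div]
    rw [h3]
    field_simp
  · have hrem := tendstoInMeasure_mul_remainder
      (fun c hc => exists_abs_sub_taylorTwo_le (contDiffAt_steinG hD) hc) htail
    refine hrem.congr_left fun n => Eventually.of_forall fun ω => ?_
    simp only [hG, hsM]
    rfl
  · rw [igAsympBias_eq_sum hμ hlam hf hf_zero hZ hθ]
    exact integral_taylorTwo_steinError hlaw hindep hZ hD hn
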